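/- Let $p$ be a prime, $q$ a power of $p$, $\bar{\mathbb F}_q$ an algebraic closure of the field with $q$ elements, and let $\Bbbk$ be a field with $p\neq\operatorname{char}\Bbbk\ge 3$ or $\operatorname{char}\Bbbk=0$. Let ${\bf G}=SL_2(\bar{\mathbb F}_q)$, regarded as an abstract group, with center ${\bf C}$, let ${\bf T}$ be the subgroup of diagonal matrices and ${\bf B}$ the subgroup of upper triangular matrices. Let $\widehat{\bf T}$ be the set of all group homomorphisms $\theta:{\bf T}\to\Bbbk^\times$, and write $\mathrm{tr}$ for the trivial one. For $\theta\in\widehat{\bf T}$ let $\Bbbk_\theta$ be the one-dimensional $\Bbbk{\bf B}$-module on which ${\bf B}$ acts through ${\bf B}\to{\bf T}\xrightarrow{\theta}\Bbbk^\times$ (the first map takes the diagonal part), let $\mathbb M(\theta)=\Bbbk{\bf G}\otimes_{\Bbbk{\bf B}}\Bbbk_\theta$ and ${\bf 1}_\theta=1\otimes 1\in\mathbb M(\theta)$. Let $\mathrm{St}$ be the $\Bbbk{\bf G}$-submodule of $\mathbb M(\mathrm{tr})$ generated by $(1-s){\bf 1}_{\mathrm{tr}}$, where $s=\begin{pmatrix}0&-1\\1&0\end{pmatrix}$;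 write $\mathrm{tr}$ also for the trivial one-dimensional $\Bbbk{\bf G}$-module. Put $$\operatorname{Irr}({\bf G},{\bf T})=\{\mathrm{tr},\ \mathrm{St},\ \mathbb M(\theta)\mid\theta\in\widehat{\bf T},\ \theta\ne\mathrm{tr}\},$$ and let $\operatorname{Ext}^1$ denote $\operatorname{Ext}^1_{\Bbbk{\bf G}}$. Then: 1. $\operatorname{Ext}^1(M,\mathrm{tr})=0$ for every $M\in\operatorname{Irr}({\bf G},{\bf T})$. 2. If $\theta\in\widehat{\bf T}$ and $\theta|_{\bf C}\ne\mathrm{tr}$, then $\operatorname{Ext}^1(\mathbb M(\theta),\mathrm{St})=\operatorname{Ext}^1(\mathrm{tr},\mathbb M(\theta))=\operatorname{Ext}^1(\mathrm{St},\mathbb M(\theta))=0$. 3. If $\lambda,\mu\in\widehat{\bf T}$ and $\lambda|_{\bf C}\ne\mu|_{\bf C}$, then $\operatorname{Ext}^1(\mathbb M(\lambda),\mathbb M(\mu))=0$. 4. For every other pair $M,N\in\operatorname{Irr}({\bf G},{\bf T})$ one has $\operatorname{Ext}^1(M,N)\ne0$. That is, $\operatorname{Ext}^1(\mathrm{tr},\mathrm{St})\ne0$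 and $\operatorname{Ext}^1(\mathrm{St},\mathrm{St})\ne0$; $\operatorname{Ext}^1(\mathbb M(\theta),\mathrm{St})$, $\operatorname{Ext}^1(\mathrm{tr},\mathbb M(\theta))$ and $\operatorname{Ext}^1(\mathrm{St},\mathbb M(\theta))$ are nonzero for every $\theta\ne\mathrm{tr}$ with $\theta|_{\bf C}=\mathrm{tr}$; and $\operatorname{Ext}^1(\mathbb M(\lambda),\mathbb M(\mu))\ne0$ for all $\lambda,\mu\neq\mathrm{tr}$ with $\lambda|_{\bf C}=\mu|_{\bf C}$. 5. Moreover, if $\theta\in\widehat{\bf T}$ is any character with $\theta|_{\bf C}=\mathrm{tr}$ (including $\theta=\mathrm{tr}$), then $\operatorname{Ext}^1(\mathrm{tr},\mathbb M(\theta))\neq0$ and $\operatorname{Ext}^1(\mathrm{St},\mathbb M(\theta))\ne0$. -/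

import Mathlib

open scoped MonoidAlgebra

universe u v

noncomputable section

namespace SL2Ext

/-- The group `G = SL₂(F)`. -/
abbrev G (F : Type u) [Field F] : Type u := Matrix.SpecialLinearGroup (Fin 2) F

section Subgroups

variable (F : Type u) [Field F]

/-- The Borel subgroup `B` of upper triangular matrices. -/
def borel : Subgroup (G F) where
  carrier := {g | g 1 0 = 0}
  one_mem' := by simp
  mul_mem' := by
    intro a b ha hb
    have ha' : a 1 0 = 0 := ha
    have hb' : b 1 0 = 0 := hb
    change (a * b) 1 0 = 0
    rw [Matrix.SpecialLinearGroup.coe_mul, Matrix.mul_apply, Fin.sum_univ_two, ha', hb']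
    ring
  inv_mem' := by
    intro a ha
    have ha' : a 1 0 = 0 := ha
    change a⁻¹ 1 0 = 0
    rw [Matrix.SpecialLinearGroup.SL2_inv_expl]
    simpa using ha'

/-- The maximal torus `T` of diagonal matrices. -/
def torus : Subgroup (G F) where
  carrier := {g | g 1 0 = 0 ∧ g 0 1 = 0}
  one_mem' := by simp
  mul_mem' := by
    rintro a b ⟨ha, ha'⟩ ⟨hb, hb'⟩
    constructor
    · rw [Matrix.SpecialLinearGroup.coe_mul, Matrix.mul_apply, Fin.sum_univ_two, ha, hb]
      ring
    · rw [Matrix.SpecialLinearGroup.coe_mul, Matrix.mul_apply, Fin.sum_univ_two, ha', hb']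
      ring
  inv_mem' := by
    rintro a ⟨ha, ha'⟩
    constructor
    · rw [Matrix.SpecialLinearGroup.SL2_inv_expl]
      simpa using ha
    · rw [Matrix.SpecialLinearGroup.SL2_inv_expl]
      simpa using ha'

/-- The center `C` of `G` is contained in `T`. -/
theorem center_le_torus : Subgroup.center (G F) ≤ torus F := by
  intro g hg
  obtain ⟨r, -, hr⟩ := Matrix.SpecialLinearGroup.mem_center_iff.mp hg
  constructor
  · rw [← hr]; simp
  · rw [← hr]; simp

variable {F}

theorem borel_det {g : G F} (hg : g ∈ borel F) : g 0 0 * g 1 1 = 1 := by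
  have h := g.det_coe
  have hg' : g 1 0 = 0 := hg
  rw [Matrix.det_fin_two, hg'] at h
  simpa using h

variable (F)

/-- The projection `B → T`, sending an upper triangular matrix to its diagonal part; its kernel
is the unipotent radical of `B`. -/
def borelToTorus : borel F →* torus F where
  toFun b := ⟨⟨!![b.1 0 0, 0; 0, b.1 1 1], by
    rw [Matrix.det_fin_two_of, borel_det b.2]; ring⟩, by constructor <;> simp⟩
  map_one' := by
    ext i j
    fin_cases i <;> fin_cases j <;> simp
  map_mul' a b := by
    have ha : a.1 1 0 = 0 := a.2
    have hb : b.1 1 0 = 0 := b.2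
    refine Subtype.ext (Subtype.ext ?_)
    change (_ : Matrix (Fin 2) (Fin 2) F) = !![_, 0; 0, _] * !![_, 0; 0, _]
    ext i j
    fin_cases i <;> fin_cases j <;> simp [Matrix.mul_apply, Fin.sum_univ_two, ha, hb]

/-- The Weyl group representative `s`, with rows `(0, -1)` and `(1, 0)`. -/
def weyl : G F := ⟨!![0, -1; 1, 0], by simp [Matrix.det_fin_two_of]⟩

end Subgroups

section Modules

variable (k F : Type u) [Field k] [Field F]

/-- The characters of `T` over `k`: all abstract homomorphisms `T → kˣ`. The trivial character
`tr` is `1`. -/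
abbrev TorusChar : Type u := torus F →* kˣ

variable {k F}

/-- The restriction of a character of `T` to the center `C` of `G`. -/
def resCenter (θ : TorusChar k F) : Subgroup.center (G F) →* kˣ :=
  θ.comp (Subgroup.inclusion (center_le_torus F))

/-- The one-dimensional representation `k_θ` of `B`, where `b` acts on `k` by the scalar
`θ (borelToTorus b)`. -/
def charRep (θ : TorusChar k F) : Representation k (borel F) k :=
  ((Algebra.lmul k k : k →* Module.End k k).comp (Units.coeHom k)).comp
    (θ.comp (borelToTorus F))

/-- The naive induced representation `kG ⊗_{kB} k_θ` of `G`. -/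
abbrev indRep (θ : TorusChar k F) :
    Representation k (G F) (Representation.IndV (borel F).subtype (charRep θ)) :=
  Representation.ind (borel F).subtype (charRep θ)

/-- The `kG`-module `M(θ) = kG ⊗_{kB} k_θ`. -/
abbrev M (θ : TorusChar k F) : ModuleCat.{u} k[G F] :=
  ModuleCat.of k[G F] (indRep θ).asModule

/-- The canonical generator `1_θ = 1 ⊗ 1` of `M(θ)`. -/
def oneVec (θ : TorusChar k F) : (indRep θ).asModule :=
  (indRep θ).asModuleEquiv.symm
    (Representation.IndV.mk (borel F).subtype (charRep θ) 1 (1 : k))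

variable (k F)

/-- The vector `η = (1 - s) 1_tr` of `M(tr)`. -/
def steinbergVec : (indRep (1 : TorusChar k F)).asModule :=
  (1 - MonoidAlgebra.of k (G F) (weyl F)) • oneVec (1 : TorusChar k F)

/-- The Steinberg module `St`, the `kG`-submodule of `M(tr)` generated by `η`. -/
abbrev St : ModuleCat.{u} k[G F] :=
  ModuleCat.of k[G F] (Submodule.span k[G F] {steinbergVec k F})

/-- The trivial `kG`-module `tr`. -/
abbrev tr : ModuleCat.{u} k[G F] :=
  ModuleCat.of k[G F] (Representation.trivial k (G F) k).asModule

variable {k F}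

/-- `Ext¹` in the category of `kG`-modules. -/
abbrev Ext1 (X Y : ModuleCat.{u} k[G F]) : Type u := CategoryTheory.Abelian.Ext.{u} X Y 1

end Modules

end SL2Ext

end

noncomputable section

namespace SL2Ext

section Ext

open CategoryTheory CategoryTheory.Abelian

variable {R : Type u} [Ring R]

/-- The short exact sequence `0 → Y → E → E / Y → 0` attached to an injection. -/
abbrev quotientComplex {Y : ModuleCat.{u} R} {E : Type u} [AddCommGroup E] [Module R E]
    (i : Y →ₗ[R] E) : ShortComplex (ModuleCat.{u} R) :=
  ShortComplex.mk (ModuleCat.ofHom i) (ModuleCat.ofHom (LinearMap.range i).mkQ) (by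
    ext x
    simp)

theorem quotientComplex_shortExact {Y : ModuleCat.{u} R} {E : Type u} [AddCommGroup E]
    [Module R E] (i : Y →ₗ[R] E) (hi : Function.Injective i) :
    (quotientComplex i).ShortExact where
  exact := by
    rw [ShortComplex.ShortExact.moduleCat_exact_iff_function_exact]
    intro x
    simp
  mono_f := (ModuleCat.mono_iff_injective _).2 hi
  epi_g := (ModuleCat.epi_iff_surjective _).2 (Submodule.mkQ_surjective _)

/-- `Ext¹(X, Y)` vanishes if every homomorphism from `X` to a quotient `E / Y` lifts to `E`. -/
theorem subsingleton_ext_of_lift (X Y : ModuleCat.{u} R)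
    (h : ∀ (E : Type u) [AddCommGroup E] [Module R E] (i : Y →ₗ[R] E), Function.Injective i →
      ∀ φ : X →ₗ[R] E ⧸ LinearMap.range i, ∃ ψ : X →ₗ[R] E, (LinearMap.range i).mkQ ∘ₗ ψ = φ) :
    Subsingleton (Ext.{u} X Y 1) := by
  refine subsingleton_of_forall_eq 0 fun e => ?_
  let i : Y →ₗ[R] (Injective.under Y : ModuleCat.{u} R) := (Injective.ι Y).hom
  have hi : Function.Injective i := (ModuleCat.mono_iff_injective (Injective.ι Y)).1 inferInstance
  have hS := quotientComplex_shortExact i hi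
  obtain ⟨x, rfl⟩ := Ext.covariant_sequence_exact₁ X hS e
    (Ext.eq_zero_of_injective (I := Injective.under Y) _) (zero_add 1)
  obtain ⟨f, rfl⟩ := Ext.addEquiv₀.symm.surjective x
  obtain ⟨ψ, hψ⟩ := h _ i hi f.hom
  have hf : f = ModuleCat.ofHom ψ ≫ (quotientComplex i).g := by
    ext1
    exact hψ.symm
  rw [Ext.addEquiv₀_symm_apply, hf, ← Ext.mk₀_comp_mk₀, Ext.comp_assoc_of_second_deg_zero,
    hS.comp_extClass, Ext.comp_zero]

/-- `Ext¹(X, Y)` does not vanish if some homomorphism from `X` to a quotient `E / Y` does not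
lift to `E`. -/
theorem nontrivial_ext_of_not_lift (X Y : ModuleCat.{u} R)
    {E : Type u} [AddCommGroup E] [Module R E] (i : Y →ₗ[R] E) (hi : Function.Injective i)
    (φ : X →ₗ[R] E ⧸ LinearMap.range i)
    (h : ∀ ψ : X →ₗ[R] E, (LinearMap.range i).mkQ ∘ₗ ψ ≠ φ) :
    Nontrivial (Ext.{u} X Y 1) := by
  have hS := quotientComplex_shortExact i hi
  refine ⟨(Ext.mk₀ (ModuleCat.ofHom φ)).comp hS.extClass (zero_add 1), 0, fun h0 => ?_⟩
  obtain ⟨x, hx⟩ := Ext.covariant_sequence_exact₃ X hS _ _ h0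
  obtain ⟨f, rfl⟩ := Ext.addEquiv₀.symm.surjective x
  rw [Ext.addEquiv₀_symm_apply, Ext.mk₀_comp_mk₀] at hx
  have := (Ext.mk₀_bijective _ _).1 hx
  exact h f.hom (congrArg ModuleCat.Hom.hom this)

/-- If `Y` is the kernel of a surjection `Z → W` and `Ext¹(X, W) = 0`, then `Ext¹(X, Y)` is
nonzero as soon as `Ext¹(X, Z)` is. -/
theorem nontrivial_ext_of_ker {X Z W : ModuleCat.{u} R} (Y : Submodule R Z) (g : Z →ₗ[R] W)
    (hg : Function.Surjective g) (hY : LinearMap.ker g = Y)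
    (hW : Subsingleton (Ext.{u} X W 1)) (hZ : Nontrivial (Ext.{u} X Z 1)) :
    Nontrivial (Ext.{u} X (ModuleCat.of R Y) 1) := by
  let S : ShortComplex (ModuleCat.{u} R) :=
    ShortComplex.mk (ModuleCat.ofHom Y.subtype) (ModuleCat.ofHom g) (by
      ext x
      have : (x : Z) ∈ LinearMap.ker g := hY ▸ x.2
      simpa using this)
  have hS : S.ShortExact :=
    { exact := by
        rw [ShortComplex.ShortExact.moduleCat_exact_iff_function_exact]
        intro x
        simp [S, ← hY]
      mono_f := (ModuleCat.mono_iff_injective _).2 Y.subtype_injective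
      epi_g := (ModuleCat.epi_iff_surjective _).2 hg }
  obtain ⟨z, hz⟩ := exists_ne (0 : Ext.{u} X Z 1)
  obtain ⟨y, rfl⟩ := Ext.covariant_sequence_exact₂ X hS z (Subsingleton.elim _ _)
  refine ⟨y, 0, ?_⟩
  rintro rfl
  exact hz (by simp)

end Ext

section Action

variable (k : Type u) {F : Type u} [Field k] [Field F]

section

variable {Z : Type*} [AddCommGroup Z] [Module k[G F] Z]

/-- The action of a group element on a module over the group algebra. -/
def act (g : G F) (z : Z) : Z := MonoidAlgebra.of k (G F) g • z

@[simp] theorem act_one (z : Z) : act k (1 : G F) z = z := by simp only [act, map_one, one_smul]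

theorem act_mul (g h : G F) (z : Z) : act k (g * h) z = act k g (act k h z) := by
  simp only [act, map_mul, mul_smul]

@[simp] theorem act_add (g : G F) (y z : Z) : act k g (y + z) = act k g y + act k g z :=
  smul_add _ _ _

@[simp] theorem act_sub (g : G F) (y z : Z) : act k g (y - z) = act k g y - act k g z :=
  smul_sub _ _ _

@[simp] theorem act_neg (g : G F) (z : Z) : act k g (-z) = -act k g z := smul_neg _ _

@[simp] theorem act_zero (g : G F) : act k g (0 : Z) = 0 := smul_zero _

variable {k} in
theorem map_act {Y : Type*} [AddCommGroup Y] [Module k[G F] Y] (f : Y →ₗ[k[G F]] Z) (g : G F)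
    (y : Y) : f (act k g y) = act k g (f y) := map_smul _ _ _

variable [Module k Z] [IsScalarTower k k[G F] Z]

@[simp] theorem act_smul (g : G F) (c : k) (z : Z) : act k g (c • z) = c • act k g z := by
  rw [act, act, ← algebraMap_smul k[G F] c z, ← algebraMap_smul k[G F] c (_ • z), ← mul_smul,
    ← mul_smul, Algebra.commutes]

variable {k} in
theorem map_smul_scalar {Y : Type*} [AddCommGroup Y] [Module k[G F] Y] [Module k Y]
    [IsScalarTower k k[G F] Y] (f : Y →ₗ[k[G F]] Z) (c : k) (y : Y) : f (c • y) = c • f y := by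
  rw [← algebraMap_smul k[G F] c y, ← algebraMap_smul k[G F] c (f y), map_smul]

variable {k} in
/-- A `k`-linear map commuting with the group is linear over the group algebra. -/
def equivariantHom {Y : Type*} [AddCommGroup Y] [Module k[G F] Y] [Module k Y]
    [IsScalarTower k k[G F] Y] (f : Y →ₗ[k] Z) (h : ∀ (g : G F) y, f (act k g y) = act k g (f y)) :
    Y →ₗ[k[G F]] Z :=
  MonoidAlgebra.equivariantOfLinearOfComm f h

variable {k} in
@[simp] theorem equivariantHom_apply {Y : Type*} [AddCommGroup Y] [Module k[G F] Y] [Module k Y]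
    [IsScalarTower k k[G F] Y] (f : Y →ₗ[k] Z) (h : ∀ (g : G F) y, f (act k g y) = act k g (f y))
    (y : Y) : equivariantHom f h y = f y := rfl

end

/-- The lifting criterion for `Ext¹ = 0`, with the scalar action of `k` made available. -/
theorem subsingleton_ext1_of_lift (X Y : ModuleCat.{u} k[G F])
    (h : ∀ (E : Type u) [AddCommGroup E] [Module k E] [Module k[G F] E] [IsScalarTower k k[G F] E]
      (i : Y →ₗ[k[G F]] E), Function.Injective i →
      ∀ φ : X →ₗ[k[G F]] E ⧸ LinearMap.range i,
        ∃ ψ : X →ₗ[k[G F]] E, (LinearMap.range i).mkQ ∘ₗ ψ = φ) :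
    Subsingleton (Ext1 X Y) := by
  refine subsingleton_ext_of_lift X Y fun E _ _ i hi φ => ?_
  let _ : Module k E := Module.compHom E (algebraMap k k[G F])
  have : IsScalarTower k k[G F] E := ⟨fun c r e => by
    rw [Algebra.smul_def, mul_smul]
    rfl⟩
  exact h E i hi φ

end Action

section Induced

variable {k F : Type u} [Field k] [Field F] (θ : TorusChar k F)

theorem act_eq_ind (g : G F) (m : (indRep θ).asModule) :
    act k g m = (indRep θ).asModuleEquiv.symm (indRep θ g ((indRep θ).asModuleEquiv m)) := by
  rw [Representation.asModuleEquiv_symm_map_rho, LinearEquiv.symm_apply_apply]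
  rfl

theorem act_oneVec (g : G F) :
    act k g (oneVec θ) = (indRep θ).asModuleEquiv.symm
      (Representation.IndV.mk (borel F).subtype (charRep θ) g⁻¹ (1 : k)) := by
  rw [act_eq_ind, oneVec, LinearEquiv.apply_symm_apply, Representation.ind_mk, one_mul]

/-- `M(θ)` is spanned over `k` by the translates of its generator. -/
theorem ind_induction {p : (indRep θ).asModule → Prop}
    (h : ∀ (c : k) (g : G F), p (c • act k g (oneVec θ)))
    (hadd : ∀ x y, p x → p y → p (x + y)) (m : (indRep θ).asModule) : p m := by
  have h0 : p 0 := by simpa using h 0 1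
  obtain ⟨x, rfl⟩ := (indRep θ).asModuleEquiv.symm.surjective m
  induction x using Representation.Coinvariants.induction_on with
  | h x =>
    induction x using TensorProduct.induction_on with
    | zero => simpa using h0
    | add x y hx hy => simpa using hadd _ _ hx hy
    | tmul x c =>
      induction x using MonoidAlgebra.induction_linear with
      | zero => simpa using h0
      | add x y hx hy => simpa [TensorProduct.add_tmul] using hadd _ _ hx hy
      | single g a =>
        have hx : MonoidAlgebra.single g a ⊗ₜ[k] c =
            (a * c) • (MonoidAlgebra.single g (1 : k) ⊗ₜ[k] (1 : k)) := by
          rw [mul_comm, mul_smul, TensorProduct.smul_tmul',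
            TensorProduct.smul_tmul', TensorProduct.smul_tmul]
          simp
        have := h (a * c) g⁻¹
        rw [act_oneVec, inv_inv, ← map_smul] at this
        rw [hx, map_smul]
        exact this

/-- A `k`-linear map out of `M(θ)` is a function on `G` which is `θ`-equivariant for right
translation by `B`. -/
theorem exists_linearMap {Z : Type*} [AddCommGroup Z] [Module k Z] (P : G F → Z)
    (hP : ∀ (g : G F) (b : borel F), P (g * b) = (θ (borelToTorus F b) : k) • P g) :
    ∃ L : (indRep θ).asModule →ₗ[k] Z, ∀ g, L (act k g (oneVec θ)) = P g := by
  let T : TensorProduct k k[G F] k →ₗ[k] Z := TensorProduct.lift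
    ((Finsupp.lift _ _ _ fun h => LinearMap.toSpanSingleton k Z (P h⁻¹)) ∘ₗ
      (MonoidAlgebra.coeffLinearEquiv k).toLinearMap)
  have hT : ∀ h c, T (MonoidAlgebra.single h 1 ⊗ₜ[k] c) = c • P h⁻¹ := fun h c => by
    simp [T]
  refine ⟨Representation.Coinvariants.lift _ T (fun b => ?_) ∘ₗ
    (indRep θ).asModuleEquiv.toLinearMap, fun g => ?_⟩
  · ext h
    simp only [LinearMap.coe_comp, Function.comp_apply, MonoidAlgebra.lsingle_apply,
      TensorProduct.AlgebraTensorModule.curry_apply, TensorProduct.curry_apply,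
      LinearMap.coe_restrictScalars, Representation.tprod_apply, TensorProduct.map_tmul]
    rw [hT, MonoidHom.comp_apply, Representation.leftRegular, Representation.ofMulAction_single, hT]
    have h1 := hP (h⁻¹ * (b : G F)⁻¹) b
    rw [inv_mul_cancel_right] at h1
    rw [one_smul, h1, smul_eq_mul, mul_inv_rev]
    congr 1
    simp [charRep]
  · rw [act_oneVec]
    rw [LinearMap.comp_apply, LinearEquiv.coe_coe, LinearEquiv.apply_symm_apply]
    change T (MonoidAlgebra.single g⁻¹ 1 ⊗ₜ[k] (1 : k)) = _
    rw [hT, inv_inv, one_smul]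

theorem act_borel_oneVec (b : borel F) :
    act k (b : G F) (oneVec θ) = (θ (borelToTorus F b) : k) • oneVec θ := by
  rw [act_oneVec, oneVec, ← map_smul, ← map_smul]
  congr 1
  have := Representation.Coinvariants.mk_inv_tmul
    ((Representation.leftRegular k (G F)).comp (borel F).subtype) (charRep θ)
    (MonoidAlgebra.single (1 : G F) (1 : k)) (1 : k) b
  have h1 : charRep θ b (1 : k) = (θ (borelToTorus F b) : k) • (1 : k) := by simp [charRep]
  rw [h1, MonoidHom.comp_apply, Representation.leftRegular, Representation.ofMulAction_single,
    smul_eq_mul, mul_one] at this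
  exact this

/-- Frobenius reciprocity: homomorphisms out of `M(θ)` are `θ`-eigenvectors of `B`. -/
theorem exists_ind_hom {Z : Type*} [AddCommGroup Z] [Module k Z] [Module k[G F] Z]
    [IsScalarTower k k[G F] Z] (z : Z)
    (hz : ∀ b : borel F, act k (b : G F) z = (θ (borelToTorus F b) : k) • z) :
    ∃ ψ : (indRep θ).asModule →ₗ[k[G F]] Z, ψ (oneVec θ) = z := by
  obtain ⟨L, hL⟩ := exists_linearMap θ (fun g => act k g z) fun g b => by
    rw [act_mul, hz, act_smul]
  refine ⟨equivariantHom L fun g m => ?_, by simpa using hL 1⟩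
  induction m using ind_induction with
  | h c h => rw [act_smul, ← act_mul, map_smul, hL, map_smul, hL, act_smul, act_mul]
  | hadd x y hx hy => rw [act_add, map_add, hx, hy, map_add, act_add]

variable {θ} in
theorem ind_hom_ext {Z : Type*} [AddCommGroup Z] [Module k[G F] Z]
    {φ ψ : (indRep θ).asModule →ₗ[k[G F]] Z} (h : φ (oneVec θ) = ψ (oneVec θ)) : φ = ψ := by
  ext m
  induction m using ind_induction with
  | h c g =>
    rw [← algebraMap_smul k[G F] c, map_smul, map_smul, map_act, map_act, h]
  | hadd x y hx hy => rw [map_add, map_add, hx, hy]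

end Induced

section Matrices

variable {F : Type u} [Field F]

/-- The upper unitriangular matrix with entry `x`. -/
def unip (x : F) : G F := ⟨!![1, x; 0, 1], by simp [Matrix.det_fin_two_of]⟩

/-- The diagonal matrix with entries `a` and `a⁻¹`. -/
def diag (a : Fˣ) : torus F :=
  ⟨⟨!![(a : F), 0; 0, (a⁻¹ : Fˣ)], by simp [Matrix.det_fin_two_of]⟩, by constructor <;> simp⟩

theorem ext_entries {g h : G F} (h00 : g 0 0 = h 0 0) (h01 : g 0 1 = h 0 1) (h10 : g 1 0 = h 1 0)
    (h11 : g 1 1 = h 1 1) : g = h := by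
  ext i j
  fin_cases i <;> fin_cases j <;> assumption

theorem mul_apply_fin_two (g h : G F) (i j : Fin 2) :
    (g * h) i j = g i 0 * h 0 j + g i 1 * h 1 j := by
  rw [Matrix.SpecialLinearGroup.coe_mul, Matrix.mul_apply, Fin.sum_univ_two]

theorem det_eq (g : G F) : g 0 0 * g 1 1 - g 0 1 * g 1 0 = 1 := by
  rw [← Matrix.det_fin_two, g.det_coe]

@[simp] theorem unip_00 (x : F) : unip x 0 0 = 1 := rfl
@[simp] theorem unip_01 (x : F) : unip x 0 1 = x := rfl
@[simp] theorem unip_10 (x : F) : unip x 1 0 = 0 := rfl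
@[simp] theorem unip_11 (x : F) : unip x 1 1 = 1 := rfl
@[simp] theorem diag_00 (a : Fˣ) : (diag a : G F) 0 0 = a := rfl
@[simp] theorem diag_01 (a : Fˣ) : (diag a : G F) 0 1 = 0 := rfl
@[simp] theorem diag_10 (a : Fˣ) : (diag a : G F) 1 0 = 0 := rfl
@[simp] theorem diag_11 (a : Fˣ) : (diag a : G F) 1 1 = (a : F)⁻¹ := by
  rw [← Units.val_inv_eq_inv_val]; rfl
@[simp] theorem weyl_00 : weyl F 0 0 = 0 := rfl
@[simp] theorem weyl_01 : weyl F 0 1 = -1 := rfl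
@[simp] theorem weyl_10 : weyl F 1 0 = 1 := rfl
@[simp] theorem weyl_11 : weyl F 1 1 = 0 := rfl

theorem mem_borel {g : G F} : g ∈ borel F ↔ g 1 0 = 0 := Iff.rfl

theorem unip_mem (x : F) : unip x ∈ borel F := rfl

theorem diag_mem (a : Fˣ) : (diag a : G F) ∈ borel F := rfl

theorem unip_add (x y : F) : unip (x + y) = unip x * unip y := by
  apply ext_entries <;> simp [mul_apply_fin_two, add_comm]

@[simp] theorem unip_zero : unip (0 : F) = 1 := by
  apply ext_entries <;> simp

theorem diag_mul (a b : Fˣ) : diag (a * b) = diag a * diag b := by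
  apply Subtype.ext
  rw [Subgroup.coe_mul]
  apply ext_entries <;> simp [mul_apply_fin_two, mul_comm]

theorem diag_mul_unip (a : Fˣ) (x : F) :
    (diag a : G F) * unip x = unip ((a : F) ^ 2 * x) * diag a := by
  apply ext_entries <;> simp [mul_apply_fin_two]
  field_simp

theorem weyl_mul_diag (a : Fˣ) : weyl F * diag a = diag a⁻¹ * weyl F := by
  apply ext_entries <;> simp [mul_apply_fin_two]

theorem weyl_mul_weyl : weyl F * weyl F = diag (-1 : Fˣ) := by
  apply ext_entries <;> simp [mul_apply_fin_two]

theorem diag_neg_one_mul (g : G F) : (diag (-1 : Fˣ) : G F) * g = g * diag (-1 : Fˣ) := by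
  apply ext_entries <;> simp [mul_apply_fin_two, inv_neg]

theorem exists_unip_mul_diag {b : G F} (hb : b ∈ borel F) :
    ∃ (x : F) (a : Fˣ), b = unip x * diag a := by
  have hd := borel_det hb
  refine ⟨b 0 0 * b 0 1, ⟨b 0 0, b 1 1, hd, by rw [mul_comm, hd]⟩, ?_⟩
  apply ext_entries
  · simp [mul_apply_fin_two]
  · have := left_ne_zero_of_mul_eq_one hd
    simp [mul_apply_fin_two]
    field_simp
  · simpa [mul_apply_fin_two] using mem_borel.1 hb
  · simpa [mul_apply_fin_two] using eq_inv_of_mul_eq_one_right hd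

theorem unip_mul_weyl_eq (g : G F) (hg : g 1 0 ≠ 0) :
    ∃ b ∈ borel F, g = unip (g 0 0 / g 1 0) * weyl F * b := by
  refine ⟨(unip (g 0 0 / g 1 0) * weyl F)⁻¹ * g, ?_, by group⟩
  rw [mem_borel, mul_apply_fin_two, Matrix.SpecialLinearGroup.SL2_inv_expl]
  simp [mul_apply_fin_two]
  field_simp
  ring

theorem borelToTorus_unip_mul_diag (x : F) (a : Fˣ) :
    borelToTorus F ⟨unip x * diag a, mul_mem (unip_mem x) (diag_mem a)⟩ = diag a := by
  apply Subtype.ext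
  apply ext_entries <;> simp [borelToTorus, mul_apply_fin_two]

/-- A property closed under products which holds for `B` and `s` holds for `G`. -/
theorem borel_weyl_induction {p : G F → Prop} (hb : ∀ b ∈ borel F, p b) (hs : p (weyl F))
    (hmul : ∀ g h, p g → p h → p (g * h)) (g : G F) : p g := by
  by_cases hg : g 1 0 = 0
  · exact hb g hg
  · obtain ⟨b, hb', h⟩ := unip_mul_weyl_eq g hg
    rw [h]
    exact hmul _ _ (hmul _ _ (hb _ (unip_mem _)) hs) (hb b hb')

end Matrices

section Characters

variable {k F : Type u} [Field k] [Field F] (θ : TorusChar k F)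

variable (F) in
theorem map_add_eq_zero {p : ℕ} [CharP F p] (hp : (p : k) ≠ 0) {E : Type*} [AddCommGroup E]
    [Module k E] (f : F → E) (hf : ∀ x y, f (x + y) = f x + f y) (x : F) : f x = 0 := by
  let f' : F →+ E := AddMonoidHom.mk' f hf
  have h : (p : k) • f' x = 0 := by
    rw [Nat.cast_smul_eq_nsmul, ← map_nsmul, nsmul_eq_mul, CharP.cast_eq_zero, zero_mul, map_zero]
  exact (smul_eq_zero.1 h).resolve_left hp

theorem map_mul_eq_zero [IsAlgClosed F] (ht : ∀ a : Fˣ, IsOfFinOrder a)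
    {E : Type*} [AddCommGroup E]
    [Module k E] (f : Fˣ → E) (hf : ∀ a b, f (a * b) = f a + f b) (a : Fˣ) : f a = 0 := by
  let f' : Additive Fˣ →+ E := AddMonoidHom.mk' (fun a => f a.toMul) fun a b => hf _ _
  have hpow : ∀ (n : ℕ) (b : Fˣ), f (b ^ n) = (n : k) • f b := fun n b => by
    rw [Nat.cast_smul_eq_nsmul]
    exact map_nsmul f' n (Additive.ofMul b)
  obtain ⟨l, hl⟩ := CharP.exists k
  rcases Nat.eq_zero_or_pos l with rfl | hl0
  · have := CharP.charP_to_charZero k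
    obtain ⟨n, hn, han⟩ := (ht a).exists_pow_eq_one
    have h := hpow n a
    have h1 : f 1 = 0 := by simpa using hpow 0 1
    rw [han, h1] at h
    exact (smul_eq_zero.1 h.symm).resolve_left (Nat.cast_ne_zero.2 hn.ne')
  · obtain ⟨z, hz⟩ := IsAlgClosed.exists_pow_nat_eq (a : F) hl0
    have hz0 : z ≠ 0 := by
      rintro rfl
      rw [zero_pow hl0.ne'] at hz
      exact a.ne_zero hz.symm
    have : a = Units.mk0 z hz0 ^ l := by
      ext
      simp [hz]
    rw [this, hpow, CharP.cast_eq_zero, zero_smul]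

theorem act_unip_oneVec (x : F) : act k (unip x) (oneVec θ) = oneVec θ := by
  have := act_borel_oneVec θ ⟨unip x * diag (1 : Fˣ), mul_mem (unip_mem x) (diag_mem 1)⟩
  rw [borelToTorus_unip_mul_diag] at this
  have h1 : diag (1 : Fˣ) = 1 := by
    apply Subtype.ext
    apply ext_entries <;> simp
  simpa [h1] using this

theorem act_diag_oneVec (a : Fˣ) :
    act k (diag a : G F) (oneVec θ) = (θ (diag a) : k) • oneVec θ := by
  have := act_borel_oneVec θ ⟨unip (0 : F) * diag a, mul_mem (unip_mem 0) (diag_mem a)⟩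
  rw [borelToTorus_unip_mul_diag] at this
  simpa using this

variable {E : Type*} [AddCommGroup E] [Module k E] [Module k[G F] E] [IsScalarTower k k[G F] E]

theorem exists_ind_hom_of_unip_diag (z : E) (hu : ∀ x : F, act k (unip x) z = z)
    (ht : ∀ a : Fˣ, act k (diag a : G F) z = (θ (diag a) : k) • z) :
    ∃ ψ : (indRep θ).asModule →ₗ[k[G F]] E, ψ (oneVec θ) = z := by
  refine exists_ind_hom θ z ?_
  rintro ⟨b, hb⟩
  obtain ⟨x, a, rfl⟩ := exists_unip_mul_diag hb
  rw [borelToTorus_unip_mul_diag, act_mul, ht, act_smul, hu]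

end Characters

section Trivial

variable (k F : Type u) [Field k] [Field F]

/-- The canonical generator of the trivial module. -/
def trVec : (Representation.trivial k (G F) k).asModule :=
  (Representation.trivial k (G F) k).asModuleEquiv.symm 1

variable {k F}

@[simp] theorem act_tr (g : G F) (y : (Representation.trivial k (G F) k).asModule) :
    act k g y = y := by
  apply (Representation.trivial k (G F) k).asModuleEquiv.injective
  rw [act, Representation.asModuleEquiv_map_smul]
  simp

variable {E : Type*} [AddCommGroup E] [Module k E] [Module k[G F] E] [IsScalarTower k k[G F] E]

theorem exists_tr_hom (z : E) (hz : ∀ g : G F, act k g z = z) :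
    ∃ ψ : (Representation.trivial k (G F) k).asModule →ₗ[k[G F]] E, ψ (trVec k F) = z := by
  refine ⟨equivariantHom (LinearMap.toSpanSingleton k E z ∘ₗ
    (Representation.trivial k (G F) k).asModuleEquiv.toLinearMap) fun g y => ?_, ?_⟩
  · simp [hz]
  · simp [trVec]

theorem tr_eq_smul_trVec (y : (Representation.trivial k (G F) k).asModule) :
    ∃ c : k, y = c • trVec k F := by
  refine ⟨(Representation.trivial k (G F) k).asModuleEquiv y, ?_⟩
  rw [trVec, ← map_smul, smul_eq_mul, mul_one, LinearEquiv.symm_apply_apply]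

end Trivial

section Central

open CategoryTheory.Abelian in
/-- If a central element acts as the identity on `X` and as zero on `Y`, then
`Ext¹(X, Y) = 0`. -/
theorem subsingleton_ext_of_central {R : Type u} [Ring R] (X Y : ModuleCat.{u} R) (r : R)
    (hr : ∀ a, Commute r a) (hX : ∀ x : X, r • x = x) (hY : ∀ y : Y, r • y = 0) :
    Subsingleton (Ext.{u} X Y 1) := by
  refine subsingleton_ext_of_lift X Y fun E _ _ i hi φ => ?_
  let T : E →ₗ[R] E :=
    { toFun := fun v => r • v
      map_add' := smul_add r
      map_smul' := fun a v => by rw [← mul_smul, (hr a).eq, mul_smul]; rfl }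
  refine ⟨(LinearMap.range i).liftQ T ?_ ∘ₗ φ, ?_⟩
  · rintro _ ⟨y, rfl⟩
    change r • i y = 0
    rw [← map_smul, hY, map_zero]
  · refine LinearMap.ext fun x => ?_
    obtain ⟨v, hv⟩ := Submodule.mkQ_surjective _ (φ x)
    rw [LinearMap.comp_apply, LinearMap.comp_apply, ← hv]
    change (LinearMap.range i).mkQ (r • v) = (LinearMap.range i).mkQ v
    rw [map_smul, hv, ← map_smul, hX]

variable {k F : Type u} [Field k] [Field F]

/-- If a central group element acts by different scalars on `X` and `Y`, then
`Ext¹(X, Y) = 0`. -/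
theorem subsingleton_ext1_of_center (X Y : ModuleCat.{u} k[G F]) (z : G F)
    (hz : z ∈ Subgroup.center (G F)) {α β : k} (hαβ : α ≠ β)
    (hX : ∀ x : X, act k z x = algebraMap k k[G F] α • x)
    (hY : ∀ y : Y, act k z y = algebraMap k k[G F] β • y) : Subsingleton (Ext1 X Y) := by
  refine subsingleton_ext_of_central X Y
    (algebraMap k k[G F] (α - β)⁻¹ * (MonoidAlgebra.of k (G F) z - algebraMap k k[G F] β))
    (fun a => ?_) (fun x => ?_) fun y => ?_
  · refine Commute.mul_left (Algebra.commutes _ _) (Commute.sub_left ?_ (Algebra.commutes _ _))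
    exact MonoidAlgebra.single_commute (fun g => (Subgroup.mem_center_iff.1 hz g).symm)
      (fun _ => Commute.one_left _) a
  · rw [mul_smul, sub_smul, ← act, hX, ← sub_smul, ← mul_smul, ← map_sub, ← map_mul,
      inv_mul_cancel₀ (sub_ne_zero.2 hαβ), map_one, one_smul]
  · rw [mul_smul, sub_smul, ← act, hY, sub_self, smul_zero]

theorem borelToTorus_center (z : Subgroup.center (G F)) :
    borelToTorus F ⟨z, (center_le_torus F z.2).1⟩ = Subgroup.inclusion (center_le_torus F) z := by
  have h := center_le_torus F z.2
  apply Subtype.ext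
  apply ext_entries
  · rfl
  · exact h.2.symm
  · exact h.1.symm
  · rfl

theorem act_center_ind (θ : TorusChar k F) (z : Subgroup.center (G F))
    (m : (indRep θ).asModule) :
    act k (z : G F) m = algebraMap k k[G F] (resCenter θ z : k) • m := by
  rw [algebraMap_smul]
  induction m using ind_induction with
  | h c g =>
    have := act_borel_oneVec θ ⟨z, (center_le_torus F z.2).1⟩
    rw [borelToTorus_center] at this
    change act k (z : G F) _ = (resCenter θ z : k) • _ at this
    rw [act_smul, ← act_mul, ← Subgroup.mem_center_iff.1 z.2, act_mul, this, act_smul, smul_comm]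
  | hadd x y hx hy => rw [act_add, hx, hy, smul_add]

theorem act_center_steinberg (z : Subgroup.center (G F)) (m : St k F) :
    act k (z : G F) m = algebraMap k k[G F] 1 • m := by
  apply Subtype.ext
  exact act_center_ind (1 : TorusChar k F) z m

theorem exists_center_ne {θ θ' : TorusChar k F} (h : resCenter θ ≠ resCenter θ') :
    ∃ z, (resCenter θ z : k) ≠ resCenter θ' z := by
  by_contra! h'
  exact h (MonoidHom.ext fun z => Units.ext (h' z))

theorem subsingleton_ext1_ind_ind {θ θ' : TorusChar k F} (h : resCenter θ ≠ resCenter θ') :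
    Subsingleton (Ext1 (M θ) (M θ')) := by
  obtain ⟨z, hz⟩ := exists_center_ne h
  exact subsingleton_ext1_of_center _ _ z z.2 hz (act_center_ind θ z) (act_center_ind θ' z)

theorem subsingleton_ext1_ind_steinberg {θ : TorusChar k F} (h : resCenter θ ≠ 1) :
    Subsingleton (Ext1 (M θ) (St k F)) := by
  obtain ⟨z, hz⟩ := exists_center_ne (θ' := 1) h
  exact subsingleton_ext1_of_center _ _ z z.2 hz (act_center_ind θ z) (act_center_steinberg z)

theorem subsingleton_ext1_steinberg_ind {θ : TorusChar k F} (h : resCenter θ ≠ 1) :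
    Subsingleton (Ext1 (St k F) (M θ)) := by
  obtain ⟨z, hz⟩ := exists_center_ne (θ' := 1) h
  exact subsingleton_ext1_of_center _ _ z z.2 hz.symm (act_center_steinberg z) (act_center_ind θ z)

theorem subsingleton_ext1_tr_ind {θ : TorusChar k F} (h : resCenter θ ≠ 1) :
    Subsingleton (Ext1 (tr k F) (M θ)) := by
  obtain ⟨z, hz⟩ := exists_center_ne (θ' := 1) h
  refine subsingleton_ext1_of_center _ _ z z.2 hz.symm (fun y => ?_) (act_center_ind θ z)
  rw [act_tr]
  change y = algebraMap k k[G F] 1 • y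
  rw [map_one, one_smul]

end Central

section Target

variable {k F : Type u} [Field k] [Field F] {E : Type*} [AddCommGroup E] [Module k E]
  [Module k[G F] E] [IsScalarTower k k[G F] E]

variable {p : ℕ} [CharP F p] (hp : (p : k) ≠ 0)

omit [IsScalarTower k k[G F] E] in
include hp in
/-- The cocycle attached to a vector fixed by `U` modulo a trivial submodule vanishes on `U`. -/
theorem act_unip_eq_self {N : Submodule k[G F] E} (hN : ∀ n ∈ N, ∀ g : G F, act k g n = n) {v : E}
    (hv : ∀ x : F, act k (unip x) v - v ∈ N) (x : F) : act k (unip x) v = v := by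
  refine sub_eq_zero.1 (map_add_eq_zero (k := k) F hp (fun x : F => act k (unip x) v - v)
    (fun x y => ?_) x)
  have := hN _ (hv y) (unip x)
  rw [act_sub] at this
  rw [unip_add, act_mul, ← sub_add_sub_cancel _ (act k (unip x) v), this, add_comm]

omit [IsScalarTower k k[G F] E] in
theorem act_diag_eq_self [IsAlgClosed F] (ht : ∀ a : Fˣ, IsOfFinOrder a) {N : Submodule k[G F] E}
    (hN : ∀ n ∈ N, ∀ g : G F, act k g n = n) {v : E}
    (hv : ∀ a : Fˣ, act k (diag a : G F) v - v ∈ N) (a : Fˣ) : act k (diag a : G F) v = v := by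
  refine sub_eq_zero.1 (map_mul_eq_zero (k := k) ht (fun a : Fˣ => act k (diag a : G F) v - v)
    (fun x y => ?_) a)
  have := hN _ (hv y) (diag x)
  rw [act_sub] at this
  rw [diag_mul, Subgroup.coe_mul, act_mul, ← sub_add_sub_cancel _ (act k (diag x : G F) v), this,
    add_comm]

omit [Module k E] [IsScalarTower k k[G F] E] in
theorem act_range_tr {i : (Representation.trivial k (G F) k).asModule →ₗ[k[G F]] E} :
    ∀ n ∈ LinearMap.range i, ∀ g : G F, act k g n = n := by
  rintro _ ⟨y, rfl⟩ g
  rw [← map_act, act_tr]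

end Target

section Vanishing

variable {k F : Type u} [Field k] [Field F] [IsAlgClosed F] {p : ℕ} [CharP F p]
  (hp : (p : k) ≠ 0) (ht : ∀ a : Fˣ, IsOfFinOrder a)

include hp ht

theorem subsingleton_ext1_ind_tr (θ : TorusChar k F) : Subsingleton (Ext1 (M θ) (tr k F)) := by
  refine subsingleton_ext1_of_lift k _ _ fun E _ _ _ _ i hi φ => ?_
  have hN := act_range_tr (i := i)
  obtain ⟨v, hv⟩ := Submodule.mkQ_surjective _ (φ (oneVec θ))
  have hu : ∀ x, act k (unip x) v = v := act_unip_eq_self hp hN fun x => by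
    rw [← Submodule.ker_mkQ (LinearMap.range i), LinearMap.mem_ker, map_sub, map_act, hv, ← map_act,
      act_unip_oneVec, sub_self]
  have hd : ∀ a, act k (diag a : G F) v - (θ (diag a) : k) • v ∈ LinearMap.range i := fun a => by
    rw [← Submodule.ker_mkQ (LinearMap.range i), LinearMap.mem_ker, map_sub, map_act,
      map_smul_scalar, hv, ← map_act,
      act_diag_oneVec, map_smul_scalar, sub_self]
  suffices ∃ n ∈ LinearMap.range i, ∀ a, act k (diag a : G F) (v - n) = (θ (diag a) : k) • (v - n) by
    obtain ⟨n, hn, h⟩ := this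
    obtain ⟨ψ, hψ⟩ := exists_ind_hom_of_unip_diag θ (v - n)
      (fun x => by rw [act_sub, hu, hN n hn]) h
    refine ⟨ψ, ind_hom_ext ?_⟩
    rw [LinearMap.comp_apply, hψ, map_sub, hv, sub_eq_self]
    rwa [← LinearMap.mem_ker, Submodule.ker_mkQ]
  by_cases hθ : ∃ a, (θ (diag a) : k) ≠ 1
  · obtain ⟨a, ha⟩ := hθ
    have ha' : 1 - (θ (diag a) : k) ≠ 0 := sub_ne_zero.2 ha.symm
    obtain ⟨n, hn, hna⟩ : ∃ n ∈ LinearMap.range i, (1 - (θ (diag a) : k)) • n =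
        act k (diag a : G F) v - (θ (diag a) : k) • v :=
      ⟨_, Submodule.smul_of_tower_mem _ _ (hd a), smul_inv_smul₀ ha' _⟩
    refine ⟨n, hn, fun b => ?_⟩
    have h1 := hN _ (hd a) (diag b)
    have h2 := hN _ (hd b) (diag a)
    have h3 : act k (diag a : G F) (act k (diag b : G F) v) =
        act k (diag b : G F) (act k (diag a : G F) v) := by
      rw [← act_mul, ← act_mul, ← Subgroup.coe_mul, ← Subgroup.coe_mul, ← diag_mul, ← diag_mul,
        mul_comm]
    rw [act_sub, act_smul] at h1 h2
    rw [h3] at h2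
    rw [act_sub, hN n hn]
    refine smul_right_injective E ha' ?_
    linear_combination (norm := module) h1 - h2 - (1 - (θ (diag b) : k)) • hna
  · push Not at hθ
    refine ⟨0, zero_mem _, fun a => ?_⟩
    rw [sub_zero, hθ, one_smul]
    exact act_diag_eq_self ht hN (fun a => by simpa [hθ] using hd a) a

theorem subsingleton_ext1_tr_tr (h2 : (2 : k) ≠ 0) : Subsingleton (Ext1 (tr k F) (tr k F)) := by
  refine subsingleton_ext1_of_lift k _ _ fun E _ _ _ _ i hi φ => ?_
  have hN := act_range_tr (i := i)
  obtain ⟨v, hv⟩ := Submodule.mkQ_surjective _ (φ (trVec k F))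
  have hg : ∀ g : G F, act k g v - v ∈ LinearMap.range i := fun g => by
    rw [← Submodule.ker_mkQ (LinearMap.range i), LinearMap.mem_ker, map_sub, map_act, hv,
      ← map_act, act_tr, sub_self]
  have hu : ∀ x : F, act k (unip x) v = v := act_unip_eq_self hp hN fun x => hg _
  have hd : ∀ a : Fˣ, act k (diag a : G F) v = v := act_diag_eq_self ht hN fun x => hg _
  obtain ⟨ψ, hψ⟩ := exists_tr_hom (k := k) (F := F) v fun g => by
    induction g using borel_weyl_induction with
    | hb b hb =>
      obtain ⟨x, a, rfl⟩ := exists_unip_mul_diag hb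
      rw [act_mul, hd, hu]
    | hs =>
      have h := hN _ (hg (weyl F)) (weyl F)
      rw [act_sub, ← act_mul, weyl_mul_weyl, hd] at h
      have h' : (2 : k) • (act k (weyl F) v - v) = 0 := by
        rw [two_smul]
        nth_rw 1 [← h]
        abel
      exact sub_eq_zero.1 ((smul_eq_zero.1 h').resolve_left h2)
    | hmul g h hg hh => rw [act_mul, hh, hg]
  refine ⟨ψ, LinearMap.ext fun (y : (Representation.trivial k (G F) k).asModule) => ?_⟩
  obtain ⟨c, rfl⟩ := tr_eq_smul_trVec y
  rw [map_smul_scalar, map_smul_scalar, LinearMap.comp_apply, hψ, hv]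

end Vanishing

section Steinberg

variable {k F : Type u} [Field k] [Field F]

variable (k F) in
/-- The canonical generator of the Steinberg module. -/
def stVec : Submodule.span k[G F] {steinbergVec k F} :=
  ⟨steinbergVec k F, Submodule.mem_span_singleton_self _⟩

theorem steinbergVec_eq : steinbergVec k F =
    oneVec (1 : TorusChar k F) - act k (weyl F) (oneVec (1 : TorusChar k F)) := by
  rw [steinbergVec, sub_smul, one_smul, act]

theorem act_borel_oneVec_one {b : G F} (hb : b ∈ borel F) :
    act k b (oneVec (1 : TorusChar k F)) = oneVec (1 : TorusChar k F) := by
  simpa using act_borel_oneVec (1 : TorusChar k F) ⟨b, hb⟩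

theorem act_diag_stVec (a : Fˣ) : act k (diag a : G F) (stVec k F) = stVec k F := by
  apply Subtype.ext
  change act k (diag a : G F) (steinbergVec k F) = steinbergVec k F
  rw [steinbergVec_eq, act_sub, act_borel_oneVec_one (diag_mem a), ← act_mul,
    ← inv_inv a, ← weyl_mul_diag, act_mul, act_borel_oneVec_one (diag_mem _)]

theorem act_weyl_stVec : act k (weyl F) (stVec k F) = -stVec k F := by
  apply Subtype.ext
  change act k (weyl F) (steinbergVec k F) = -steinbergVec k F
  rw [steinbergVec_eq, act_sub, ← act_mul, weyl_mul_weyl, act_borel_oneVec_one (diag_mem _),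
    neg_sub]

theorem act_weyl_unip_stVec {x : F} (hx : x ≠ 0) :
    act k (weyl F) (act k (unip x) (stVec k F)) = act k (unip (-x⁻¹)) (stVec k F) - stVec k F := by
  apply Subtype.ext
  change act k (weyl F) (act k (unip x) (steinbergVec k F)) =
    act k (unip (-x⁻¹)) (steinbergVec k F) - steinbergVec k F
  have h10 : (weyl F * unip x * weyl F) 1 0 = x := by simp [mul_apply_fin_two]
  have h00 : (weyl F * unip x * weyl F) 0 0 = -1 := by simp [mul_apply_fin_two]
  obtain ⟨b, hb, h⟩ := unip_mul_weyl_eq (weyl F * unip x * weyl F) (by rwa [h10])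
  rw [h10, h00, neg_div, one_div] at h
  have h' : act k (weyl F) (act k (unip x) (act k (weyl F) (oneVec (1 : TorusChar k F)))) =
      act k (unip (-x⁻¹)) (act k (weyl F) (oneVec (1 : TorusChar k F))) := by
    rw [← act_mul, ← act_mul, h, act_mul, act_borel_oneVec_one hb, act_mul]
  rw [steinbergVec_eq, act_sub, act_sub, act_sub, h', act_borel_oneVec_one (unip_mem x),
    act_borel_oneVec_one (unip_mem _)]
  abel

theorem steinberg_hom_ext {Z : Type*} [AddCommGroup Z] [Module k[G F] Z]
    {φ ψ : Submodule.span k[G F] {steinbergVec k F} →ₗ[k[G F]] Z}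
    (h : φ (stVec k F) = ψ (stVec k F)) : φ = ψ := by
  ext ⟨m, hm⟩
  obtain ⟨r, rfl⟩ := Submodule.mem_span_singleton.1 hm
  change φ (r • stVec k F) = ψ (r • stVec k F)
  rw [map_smul, map_smul, h]

theorem act_sub_mem_steinberg (g : G F) :
    act k g (oneVec (1 : TorusChar k F)) - oneVec (1 : TorusChar k F) ∈
      Submodule.span k[G F] {steinbergVec k F} := by
  induction g using borel_weyl_induction with
  | hb b hb =>
    rw [act_borel_oneVec_one hb, sub_self]
    exact zero_mem _
  | hs =>
    rw [← neg_mem_iff, neg_sub, ← steinbergVec_eq]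
    exact Submodule.mem_span_singleton_self _
  | hmul g h hg hh =>
    rw [act_mul, ← sub_add_sub_cancel _ (act k g (oneVec 1)), ← act_sub]
    exact add_mem (Submodule.smul_mem _ _ hh) hg

variable (k F) in
/-- The augmentation of `M(tr)` is surjective with kernel the Steinberg module. -/
theorem exists_augmentation :
    ∃ ε : (indRep (1 : TorusChar k F)).asModule →ₗ[k[G F]]
        (Representation.trivial k (G F) k).asModule,
      ε (oneVec 1) = trVec k F ∧ Function.Surjective ε ∧
      LinearMap.ker ε = Submodule.span k[G F] {steinbergVec k F} := by
  obtain ⟨ε, hε⟩ := exists_ind_hom_of_unip_diag (1 : TorusChar k F) (trVec k F) (by simp) (by simp)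
  refine ⟨ε, hε, fun y => ?_, le_antisymm (fun m hm => ?_) ?_⟩
  · obtain ⟨c, rfl⟩ := tr_eq_smul_trVec y
    exact ⟨c • oneVec 1, by rw [map_smul_scalar, hε]⟩
  · have key : ∀ m, ∃ c : k, ε m = c • trVec k F ∧
        m - c • oneVec (1 : TorusChar k F) ∈ Submodule.span k[G F] {steinbergVec k F} := by
      intro m
      induction m using ind_induction with
      | h c g =>
        refine ⟨c, by rw [map_smul_scalar, map_act, hε, act_tr], ?_⟩
        rw [← smul_sub]
        exact Submodule.smul_of_tower_mem _ c (act_sub_mem_steinberg g)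
      | hadd x y hx hy =>
        obtain ⟨c, hc, hc'⟩ := hx
        obtain ⟨d, hd, hd'⟩ := hy
        refine ⟨c + d, by rw [map_add, hc, hd, add_smul], ?_⟩
        rw [add_smul, add_sub_add_comm]
        exact add_mem hc' hd'
    obtain ⟨c, hc, hm'⟩ := key m
    rw [LinearMap.mem_ker.1 hm] at hc
    have hc0 : c = 0 := by
      have := congrArg (Representation.trivial k (G F) k).asModuleEquiv hc
      simpa [trVec] using this.symm
    simpa [hc0] using hm'
  · rw [Submodule.span_le, Set.singleton_subset_iff, SetLike.mem_coe, LinearMap.mem_ker,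
      steinbergVec_eq, map_sub, map_act, hε, act_tr, sub_self]

variable {E : Type*} [AddCommGroup E] [Module k E] [Module k[G F] E] [IsScalarTower k k[G F] E]

/-- A 1-cocycle of `G` which vanishes on `B` defines a homomorphism out of the Steinberg
module. -/
theorem exists_steinberg_hom_of_cocycle (P : G F → E)
    (hP : ∀ g h, P (g * h) = P g + act k g (P h)) (hB : ∀ b ∈ borel F, P b = 0) :
    ∃ ψ : Submodule.span k[G F] {steinbergVec k F} →ₗ[k[G F]] E,
      ψ (stVec k F) = -P (weyl F) := by
  obtain ⟨L, hL⟩ := exists_linearMap (1 : TorusChar k F) P fun g b => by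
    rw [hP, hB _ b.2, act_zero, add_zero, MonoidHom.one_apply, Units.val_one, one_smul]
  obtain ⟨ε, hε, -, hker⟩ := exists_augmentation k F
  let e := (Representation.trivial k (G F) k).asModuleEquiv
  have hLg : ∀ g m, L (act k g m) = act k g (L m) + e (ε m) • P g := fun g m => by
    induction m using ind_induction with
    | h c h =>
      have he : e (trVec k F) = 1 := LinearEquiv.apply_symm_apply _ _
      rw [act_smul, ← act_mul, map_smul, hL, map_smul, hL, hP, act_smul, map_smul_scalar, map_act,
        hε, act_tr, map_smul, he, smul_eq_mul, mul_one, smul_add, add_comm]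
    | hadd x y hx hy => rw [act_add, map_add, hx, hy, map_add, map_add, map_add, act_add, add_smul,
        add_add_add_comm]
  let N : Submodule k[G F] _ := Submodule.span k[G F] {steinbergVec k F}
  refine ⟨equivariantHom (L ∘ₗ (N.subtype.restrictScalars k)) fun g y => ?_, ?_⟩
  · have hy : ε y = 0 := LinearMap.mem_ker.1 (hker.ge y.2)
    change L (act k g (y : (indRep (1 : TorusChar k F)).asModule)) = act k g (L y)
    rw [hLg, hy, map_zero, zero_smul, add_zero]
  · change L (steinbergVec k F) = _
    have h1 := hL 1
    rw [act_one, hB 1 (one_mem _)] at h1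
    rw [steinbergVec_eq, map_sub, hL, h1, zero_sub]

/-- A presentation of the Steinberg module. -/
theorem exists_steinberg_hom (z : E) (hd : ∀ a : Fˣ, act k (diag a : G F) z = z)
    (hs : act k (weyl F) z = -z)
    (hr : ∀ x : F, x ≠ 0 → act k (weyl F) (act k (unip x) z) = act k (unip (-x⁻¹)) z - z) :
    ∃ ψ : Submodule.span k[G F] {steinbergVec k F} →ₗ[k[G F]] E, ψ (stVec k F) = z := by
  classical
  let P : G F → E := fun g => if g 1 0 = 0 then 0 else -act k (unip (g 0 0 / g 1 0)) z
  have hP0 : ∀ g : G F, g 1 0 = 0 → P g = 0 := fun g h => if_pos h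
  have hP1 : ∀ g : G F, g 1 0 ≠ 0 → P g = -act k (unip (g 0 0 / g 1 0)) z := fun g h => if_neg h
  have hPs : P (weyl F) = -z := by rw [hP1 _ (by simp)]; simp
  suffices hP : ∀ g h, P (g * h) = P g + act k g (P h) by
    obtain ⟨ψ, hψ⟩ := exists_steinberg_hom_of_cocycle P hP hP0
    exact ⟨ψ, by rw [hψ, hPs, neg_neg]⟩
  intro g
  have hmul : ∀ g h : G F, (∀ h', P (g * h') = P g + act k g (P h')) →
      (∀ h', P (h * h') = P h + act k h (P h')) →
      ∀ h', P (g * h * h') = P (g * h) + act k (g * h) (P h') := fun g h hg hh h' => by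
    rw [mul_assoc, hg, hh, hg, act_add, act_mul, add_assoc]
  induction g using borel_weyl_induction with
  | hb b hb =>
    obtain ⟨x, a, rfl⟩ := exists_unip_mul_diag hb
    refine hmul _ _ (fun h => ?_) fun h => ?_
    · have h10 : (unip x * h) 1 0 = h 1 0 := by simp [mul_apply_fin_two]
      have h00 : (unip x * h) 0 0 = h 0 0 + x * h 1 0 := by simp [mul_apply_fin_two]
      rw [hP0 _ (unip_mem x), zero_add]
      by_cases hh : h 1 0 = 0
      · rw [hP0 _ hh, hP0 _ (h10.trans hh), act_zero]
      · rw [hP1 _ hh, hP1 _ (by rwa [h10]), h10, h00, act_neg, ← act_mul, ← unip_add, add_div,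
          mul_div_cancel_right₀ _ hh, add_comm]
    · have h10 : ((diag a : G F) * h) 1 0 = (a : F)⁻¹ * h 1 0 := by simp [mul_apply_fin_two]
      have h00 : ((diag a : G F) * h) 0 0 = a * h 0 0 := by simp [mul_apply_fin_two]
      rw [hP0 _ (diag_mem a), zero_add]
      by_cases hh : h 1 0 = 0
      · rw [hP0 _ hh, hP0 _ (by rw [h10, hh, mul_zero]), act_zero]
      · rw [hP1 _ hh, hP1 _ (by rw [h10]; simp [hh]), h10, h00, act_neg, ← act_mul, diag_mul_unip,
          act_mul, hd]
        congr 3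
        field_simp
  | hs =>
    intro h
    have h10 : (weyl F * h) 1 0 = h 0 0 := by simp [mul_apply_fin_two]
    have h00 : (weyl F * h) 0 0 = -h 1 0 := by simp [mul_apply_fin_two]
    rw [hPs]
    by_cases hh : h 1 0 = 0
    · have hh' : h 0 0 ≠ 0 := left_ne_zero_of_mul_eq_one (borel_det hh)
      rw [hP0 _ hh, hP1 _ (by rwa [h10]), h10, h00, hh]
      simp
    · rw [hP1 _ hh, act_neg]
      by_cases hh' : h 0 0 = 0
      · rw [hP0 _ (h10.trans hh'), hh', zero_div, unip_zero, act_one, hs]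
        simp
      · rw [hP1 _ (by rwa [h10]), h10, h00, hr _ (div_ne_zero hh' hh), inv_div, neg_div]
        abel
  | hmul g h hg hh => exact hmul g h hg hh

end Steinberg

section Vanishing

variable {k F : Type u} [Field k] [Field F] [IsAlgClosed F] (ht : ∀ a : Fˣ, IsOfFinOrder a)

include ht in
theorem subsingleton_ext1_steinberg_tr (h2 : (2 : k) ≠ 0) :
    Subsingleton (Ext1 (St k F) (tr k F)) := by
  refine subsingleton_ext1_of_lift k _ _ fun E _ _ _ _ i hi φ => ?_
  have hN := act_range_tr (i := i)
  obtain ⟨v₀, hv₀⟩ := Submodule.mkQ_surjective _ (φ (stVec k F))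
  have hd₀ : ∀ a : Fˣ, act k (diag a : G F) v₀ = v₀ := act_diag_eq_self ht hN fun a => by
    rw [← Submodule.ker_mkQ (LinearMap.range i), LinearMap.mem_ker, map_sub, map_act, hv₀,
      ← map_act, act_diag_stVec, sub_self]
  have hs₀ : act k (weyl F) v₀ + v₀ ∈ LinearMap.range i := by
    rw [← Submodule.ker_mkQ (LinearMap.range i), LinearMap.mem_ker, map_add, map_act, hv₀,
      ← map_act, act_weyl_stVec, map_neg, neg_add_cancel]
  obtain ⟨n, hn, hn2⟩ : ∃ n ∈ LinearMap.range i, (2 : k) • n = act k (weyl F) v₀ + v₀ :=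
    ⟨_, Submodule.smul_of_tower_mem _ _ hs₀, smul_inv_smul₀ h2 _⟩
  obtain ⟨v, hvn⟩ : ∃ v, v = v₀ - n := ⟨_, rfl⟩
  have hv : (LinearMap.range i).mkQ v = φ (stVec k F) := by
    rw [hvn, map_sub, hv₀, sub_eq_self]
    rwa [← LinearMap.mem_ker, Submodule.ker_mkQ]
  have hd : ∀ a : Fˣ, act k (diag a : G F) v = v := fun a => by rw [hvn, act_sub, hd₀, hN n hn]
  have hs : act k (weyl F) v = -v := by
    rw [hvn, act_sub, hN n hn, ← sub_eq_zero]
    linear_combination (norm := module) -hn2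
  have hss : ∀ z : E, act k (weyl F) (act k (weyl F) z) = act k (diag (-1 : Fˣ) : G F) z :=
    fun z => by rw [← act_mul, weyl_mul_weyl]
  let c : F → E := fun x => act k (weyl F) (act k (unip x) v) - (act k (unip (-x⁻¹)) v - v)
  have hc : ∀ x ≠ 0, c x ∈ LinearMap.range i := fun x hx => by
    rw [← Submodule.ker_mkQ (LinearMap.range i), LinearMap.mem_ker]
    simp only [c, map_sub, map_act, hv]
    rw [← map_act, ← map_act, ← map_act, act_weyl_unip_stVec hx, map_sub, sub_self]
  have hc_weyl : ∀ x ≠ 0, c x = -c (-x⁻¹) := fun x hx => by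
    have h := hN _ (hc x hx) (weyl F)
    have hx' : -(-x⁻¹)⁻¹ = x := by rw [inv_neg, inv_inv, neg_neg]
    have h1 : act k (weyl F) (act k (weyl F) (act k (unip x) v)) = act k (unip x) v := by
      rw [hss, ← act_mul, diag_neg_one_mul, act_mul, hd]
    simp only [c, act_sub, h1, hs, hx'] at h ⊢
    rw [← h]
    abel
  have hc_diag : ∀ x ≠ 0, ∀ a : Fˣ, c ((a : F) ^ 2 * x) = c x := fun x hx a => by
    have h := hN _ (hc x hx) (diag a⁻¹)
    rw [← h]
    have h1 : act k (weyl F) (act k (unip ((a : F) ^ 2 * x)) v) =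
        act k (diag a⁻¹ : G F) (act k (weyl F) (act k (unip x) v)) := by
      rw [← act_mul _ (diag a⁻¹ : G F), ← weyl_mul_diag, act_mul, ← act_mul k (diag a : G F),
        diag_mul_unip, act_mul, hd]
    have h2 : act k (diag a⁻¹ : G F) (act k (unip (-x⁻¹)) v) =
        act k (unip (-((a : F) ^ 2 * x)⁻¹)) v := by
      rw [← act_mul, diag_mul_unip, act_mul, hd]
      congr 2
      rw [Units.val_inv_eq_inv_val]
      field_simp
    simp only [c, act_sub, h1, h2, hd]
  have hc0 : ∀ x ≠ 0, c x = 0 := fun x hx => by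
    obtain ⟨j, hj⟩ := IsAlgClosed.exists_pow_nat_eq (-1 : F) two_pos
    have hj0 : j ≠ 0 := by
      rintro rfl
      simp at hj
    have h := hc_diag x hx (Units.mk0 (j * x⁻¹) (mul_ne_zero hj0 (inv_ne_zero hx)))
    rw [Units.val_mk0, mul_pow, hj] at h
    have hx' : -1 * x⁻¹ ^ 2 * x = -x⁻¹ := by field_simp
    have h' := hc_weyl x hx
    rw [hx'] at h
    rw [h] at h'
    have : (2 : k) • c x = 0 := by
      rw [two_smul]
      nth_rw 1 [h']
      exact neg_add_cancel _
    exact (smul_eq_zero.1 this).resolve_left h2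
  obtain ⟨ψ, hψ⟩ := exists_steinberg_hom v hd hs fun x hx => sub_eq_zero.1 (hc0 x hx)
  exact ⟨ψ, steinberg_hom_ext (by rw [LinearMap.comp_apply, hψ, hv])⟩

end Vanishing

/-- An exhaustion of `F` by finite subfields `K n`, with elements `x n` of `K (n + 1)` which are
roots of no nonzero polynomial of degree at most two over `K n`. -/
structure Tower (F : Type u) [Field F] where
  /-- The finite subfields. -/
  K : ℕ → Subfield F
  finite : ∀ n, Finite (K n)
  mono : Monotone K
  exhaust : ∀ y, ∃ n, y ∈ K n
  /-- The elements which are not quadratic over the preceding subfield. -/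
  x : ℕ → F
  x_mem : ∀ n, x n ∈ K (n + 1)
  not_quadratic : ∀ n, ∀ a ∈ K n, ∀ b ∈ K n, ∀ c ∈ K n, a * x n ^ 2 + b * x n + c = 0 →
    a = 0 ∧ b = 0 ∧ c = 0

section Existence

variable {F : Type u} [Field F]

theorem finite_quadratic_roots (K : Subfield F) [Finite K] :
    {y : F | ∃ a ∈ K, ∃ b ∈ K, ∃ c ∈ K, a * y ^ 2 + b * y + c = 0 ∧
      ¬(a = 0 ∧ b = 0 ∧ c = 0)}.Finite := by
  have h : ∀ t : K × K × K, {y : F | (t.1 : F) * y ^ 2 + t.2.1 * y + t.2.2 = 0 ∧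
      ¬((t.1 : F) = 0 ∧ (t.2.1 : F) = 0 ∧ (t.2.2 : F) = 0)}.Finite := by
    rintro ⟨a, b, c⟩
    by_cases h0 : (a : F) = 0 ∧ (b : F) = 0 ∧ (c : F) = 0
    · simp [h0]
    · let f : Polynomial F := .C (a : F) * .X ^ 2 + .C (b : F) * .X + .C (c : F)
      have hf : f ≠ 0 := fun hf => h0 ⟨by simpa [f] using congrArg (Polynomial.coeff · 2) hf,
        by simpa [f] using congrArg (Polynomial.coeff · 1) hf,
        by simpa [f] using congrArg (Polynomial.coeff · 0) hf⟩
      refine (Polynomial.finite_setOfPred_isRoot hf).subset fun y hy => ?_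
      simpa [f, Polynomial.IsRoot] using hy.1
  refine (Set.finite_iUnion h).subset ?_
  rintro y ⟨a, ha, b, hb, c, hc, h1⟩
  exact Set.mem_iUnion.2 ⟨(⟨a, ha⟩, ⟨b, hb⟩, ⟨c, hc⟩), h1⟩

theorem exists_exhaustion (p : ℕ) [Fact p.Prime] [CharP F p] (Fq : Type v) [Field Fq] [Finite Fq]
    [Algebra Fq F] [Algebra.IsAlgebraic Fq F] :
    ∃ K : ℕ → Subfield F, (∀ n, Finite (K n)) ∧ Monotone K ∧ ∀ y, ∃ n, y ∈ K n := by
  have hmem : ∀ (n : ℕ) (y : F), y ∈ (iterateFrobenius F p n).eqLocusField (RingHom.id F) ↔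
      Function.IsPeriodicPt (frobenius F p) n y := fun n y => by
    rw [Function.IsPeriodicPt, Function.IsFixedPt, ← coe_iterateFrobenius]
    rfl
  refine ⟨fun n => (iterateFrobenius F p n.factorial).eqLocusField (RingHom.id F), fun n => ?_,
    fun m n hmn y hy => ?_, fun y => ?_⟩
  · have hp : p.Prime := Fact.out
    have hf := FiniteField.X_pow_card_pow_sub_X_ne_zero F n.factorial_ne_zero hp.one_lt
    refine ((Polynomial.finite_setOfPred_isRoot hf).subset fun y hy => ?_).to_subtype
    have : y ^ p ^ n.factorial = y := by
      rw [← iterateFrobenius_def]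
      exact hy
    simp [Polynomial.IsRoot, this]
  · rw [hmem] at hy ⊢
    exact hy.trans_dvd (Nat.factorial_dvd_factorial hmn)
  · have hy : IsIntegral Fq y := Algebra.IsIntegral.isIntegral y
    let L := IntermediateField.adjoin Fq {y}
    have : FiniteDimensional Fq L := IntermediateField.adjoin.finiteDimensional hy
    have : Finite L := Module.finite_of_finite Fq
    have := Fintype.ofFinite L
    have : CharP L p := (algebraMap L F).charP (algebraMap L F).injective p
    obtain ⟨d, -, hd⟩ := FiniteField.card L p
    refine ⟨d, (hmem _ _).2 ?_⟩
    refine Function.IsPeriodicPt.trans_dvd (m := d) ?_ (Nat.dvd_factorial d.pos le_rfl)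
    have h := FiniteField.pow_card (⟨y, IntermediateField.mem_adjoin_simple_self Fq y⟩ : L)
    rw [hd] at h
    rw [Function.IsPeriodicPt, Function.IsFixedPt, ← coe_iterateFrobenius, iterateFrobenius_def]
    exact congrArg Subtype.val h

theorem exists_tower [Infinite F] (p : ℕ) [Fact p.Prime] [CharP F p] (Fq : Type v) [Field Fq]
    [Finite Fq] [Algebra Fq F] [Algebra.IsAlgebraic Fq F] : Nonempty (Tower F) := by
  obtain ⟨K, hfin, hmono, hex⟩ := exists_exhaustion (F := F) p Fq
  have hy : ∀ n, ∃ y : F, ∀ a ∈ K n, ∀ b ∈ K n, ∀ c ∈ K n, a * y ^ 2 + b * y + c = 0 →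
      a = 0 ∧ b = 0 ∧ c = 0 := fun n => by
    obtain ⟨y, hy⟩ := (finite_quadratic_roots (K n)).exists_notMem
    exact ⟨y, fun a ha b hb c hc h => by_contra fun h' => hy ⟨a, ha, b, hb, c, hc, h, h'⟩⟩
  choose y hy using hy
  choose m hm using fun n => hex (y n)
  let φ : ℕ → ℕ := fun n => Nat.rec 0 (fun _ r => max (r + 1) (m r)) n
  have hφ : ∀ n, φ (n + 1) = max (φ n + 1) (m (φ n)) := fun n => rfl
  have hφm : StrictMono φ := strictMono_nat_of_lt_succ fun n => by
    rw [hφ]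
    exact lt_max_of_lt_left (Nat.lt_succ_self _)
  exact ⟨{
    K := fun n => K (φ n)
    finite := fun n => hfin _
    mono := hmono.comp hφm.monotone
    exhaust := fun z => by
      obtain ⟨n, hn⟩ := hex z
      exact ⟨n, hmono (hφm.id_le n) hn⟩
    x := fun n => y (φ n)
    x_mem := fun n => hmono (by rw [hφ]; exact le_max_right _ _) (hm (φ n))
    not_quadratic := fun n => hy (φ n) }⟩

end Existence

namespace Tower

variable {F : Type u} [Field F] (T : Tower F)

/-- The finite subgroup of matrices with entries in `K n`. -/
def sl (n : ℕ) : Subgroup (G F) where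
  carrier := {g | ∀ i j, g i j ∈ T.K n}
  one_mem' i j := by
    rw [Matrix.SpecialLinearGroup.coe_one, Matrix.one_apply]
    split_ifs
    exacts [one_mem _, zero_mem _]
  mul_mem' {g h} hg hh i j := by
    rw [mul_apply_fin_two]
    exact add_mem (mul_mem (hg _ _) (hh _ _)) (mul_mem (hg _ _) (hh _ _))
  inv_mem' {g} hg i j := by
    rw [Matrix.SpecialLinearGroup.SL2_inv_expl]
    fin_cases i <;> fin_cases j <;> simp [hg _ _]

theorem mem_sl {n : ℕ} {g : G F} : g ∈ T.sl n ↔ ∀ i j, g i j ∈ T.K n := Iff.rfl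

instance (n : ℕ) : Finite (T.sl n) := by
  have := T.finite n
  refine Finite.of_injective (β := Fin 2 → Fin 2 → T.K n) (fun g i j => ⟨g.1 i j, g.2 i j⟩) ?_
  intro g h hgh
  apply Subtype.ext
  ext i j
  exact congrArg Subtype.val (congrFun (congrFun hgh i) j)

theorem sl_mono : Monotone T.sl := fun _ _ hmn _ hg i j => T.mono hmn (hg i j)

theorem exists_mem_sl (g : G F) : ∃ n, g ∈ T.sl n := by
  choose n hn using fun i j => T.exhaust (g i j)
  refine ⟨max (max (n 0 0) (n 0 1)) (max (n 1 0) (n 1 1)), fun i j => T.mono ?_ (hn i j)⟩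
  fin_cases i <;> fin_cases j <;> simp

theorem weyl_mem_sl (n : ℕ) : weyl F ∈ T.sl n := fun i j => by
  fin_cases i <;> fin_cases j <;> simp

/-- A group element moving the base point `∞` of the projective line to `x n`. -/
def pt (n : ℕ) : G F := unip (T.x n) * weyl F

theorem pt_00 (n : ℕ) : T.pt n 0 0 = T.x n := by simp [pt, mul_apply_fin_two]

theorem pt_10 (n : ℕ) : T.pt n 1 0 = 1 := by simp [pt, mul_apply_fin_two]

theorem x_ne_zero (n : ℕ) : T.x n ≠ 0 := fun h => by
  have := T.not_quadratic n 0 (zero_mem _) 1 (one_mem _) 0 (zero_mem _) (by simp [h])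
  simp at this

theorem pt_mem (n : ℕ) : T.pt n ∈ T.sl (n + 1) := by
  refine mul_mem (fun i j => ?_) (T.weyl_mem_sl _)
  fin_cases i <;> fin_cases j <;> simp [T.x_mem]

theorem not_lt_of_mem_borel {m n : ℕ} {g h : G F} (hg : g ∈ T.sl n) (hh : h ∈ T.sl m)
    (hb : (h * T.pt m)⁻¹ * (g * T.pt n) ∈ borel F) : ¬n < m := fun hnm => by
  obtain ⟨b, hb', hgb⟩ : ∃ b ∈ borel F, h⁻¹ * (g * T.pt n) = T.pt m * b :=
    ⟨_, hb, by group⟩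
  have hmem : T.pt m * b ∈ T.sl m := by
    rw [← hgb]
    exact mul_mem (inv_mem hh) (mul_mem (T.sl_mono hnm.le hg) (T.sl_mono hnm (T.pt_mem n)))
  have h0 := hmem 0 0
  have h1 := hmem 1 0
  rw [mul_apply_fin_two, mem_borel.1 hb', mul_zero, add_zero] at h0 h1
  rw [pt_00] at h0
  rw [pt_10, one_mul] at h1
  have := T.not_quadratic m 0 (zero_mem _) (b 0 0) h1 (-(T.x m * b 0 0)) (neg_mem h0) (by ring)
  exact left_ne_zero_of_mul_eq_one (borel_det hb') this.2.1

/-- Orbits of points of different levels are disjoint. -/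
theorem eq_of_mem_borel {m n : ℕ} {g h : G F} (hg : g ∈ T.sl n) (hh : h ∈ T.sl m)
    (hb : (h * T.pt m)⁻¹ * (g * T.pt n) ∈ borel F) : n = m := by
  refine le_antisymm (not_lt.1 (T.not_lt_of_mem_borel hh hg ?_))
    (not_lt.1 (T.not_lt_of_mem_borel hg hh hb))
  simpa using inv_mem hb

/-- The stabilizer of `x n` in the group of level `n` is `{1, -1}`. -/
theorem eq_one_or_of_mem_borel {n : ℕ} {g : G F} (hg : g ∈ T.sl n)
    (hb : (T.pt n)⁻¹ * (g * T.pt n) ∈ borel F) : g = 1 ∨ g = diag (-1 : Fˣ) := by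
  obtain ⟨b, hb', hgb⟩ : ∃ b ∈ borel F, g * T.pt n = T.pt n * b := ⟨_, hb, by group⟩
  have h0 := congrArg (fun g : G F => g 0 0) hgb
  have h1 := congrArg (fun g : G F => g 1 0) hgb
  simp only [mul_apply_fin_two, mem_borel.1 hb', mul_zero, add_zero, pt_00, pt_10, one_mul,
    mul_one] at h0 h1
  obtain ⟨h10, hd, h01⟩ := T.not_quadratic n (g 1 0) (hg _ _) (g 1 1 - g 0 0)
    (sub_mem (hg _ _) (hg _ _)) (-g 0 1) (neg_mem (hg _ _)) (by
      rw [← h1] at h0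
      linear_combination -h0)
  rw [neg_eq_zero] at h01
  have hd' := sub_eq_zero.1 hd
  have hdet := det_eq g
  rw [h10, hd', mul_zero, sub_zero, mul_self_eq_one_iff] at hdet
  rcases hdet with h | h
  · left
    apply ext_entries <;> simp [h10, h01, hd', h]
  · right
    apply ext_entries <;> simp [h10, h01, hd', h, inv_neg]

end Tower

section Functions

theorem inv_10 {F : Type u} [Field F] (g : G F) : g⁻¹ 1 0 = -g 1 0 := by
  rw [Matrix.SpecialLinearGroup.SL2_inv_expl]
  rfl

theorem inv_11 {F : Type u} [Field F] (g : G F) : g⁻¹ 1 1 = g 0 0 := by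
  rw [Matrix.SpecialLinearGroup.SL2_inv_expl]
  rfl

variable (k F : Type u) [Field k] [Field F]

/-- The left translation action of `G` on all functions `G → k`. -/
def funRep : Representation k (G F) (G F → k) where
  toFun g := LinearMap.funLeft k k fun h => g⁻¹ * h
  map_one' := by
    ext f h
    simp [LinearMap.funLeft_apply]
  map_mul' g h := by
    ext f x
    simp [LinearMap.funLeft_apply, mul_assoc]

/-- The `kG`-module of all functions `G → k`. -/
abbrev FunModule : Type u := (funRep k F).asModule

variable {k F}

/-- Evaluation of a function at a group element. -/
def ev (g : G F) : FunModule k F →ₗ[k] k :=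
  LinearMap.proj g ∘ₗ (funRep k F).asModuleEquiv.toLinearMap

theorem ev_act (g h : G F) (f : FunModule k F) : ev g (act k h f) = ev (h⁻¹ * g) f := by
  simp only [ev, act, LinearMap.comp_apply, LinearEquiv.coe_coe,
    Representation.asModuleEquiv_map_smul, Representation.asAlgebraHom_of]
  rfl

theorem fun_ext {f f' : FunModule k F} (h : ∀ g, ev g f = ev g f') : f = f' :=
  (funRep k F).asModuleEquiv.injective (funext h)

/-- The element of the function module with given values. -/
def ofFun (f : G F → k) : FunModule k F := (funRep k F).asModuleEquiv.symm f

@[simp] theorem ev_ofFun (f : G F → k) (g : G F) : ev g (ofFun f) = f g := by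
  simp [ev, ofFun]

variable (μ : TorusChar k F)

open Classical in
/-- The function supported on `B` which equals `μ⁻¹` there. -/
def delta : FunModule k F :=
  ofFun fun g => if h : g ∈ borel F then ((μ (borelToTorus F ⟨g, h⟩))⁻¹ : kˣ) else 0

theorem ev_delta {g : G F} (hg : g ∈ borel F) :
    ev g (delta μ) = ((μ (borelToTorus F ⟨g, hg⟩))⁻¹ : kˣ) := by
  rw [delta, ev_ofFun, dif_pos hg]

theorem ev_delta_eq_zero {g : G F} (hg : g ∉ borel F) : ev g (delta μ) = 0 := by
  rw [delta, ev_ofFun, dif_neg hg]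

theorem mem_borel_of_ev_delta_ne_zero {g : G F} (hg : ev g (delta μ) ≠ 0) : g ∈ borel F :=
  by_contra fun h => hg (ev_delta_eq_zero μ h)

theorem ev_delta_mul (g : G F) (b : borel F) :
    ev (g * (b : G F)) (delta μ) = ((μ (borelToTorus F b))⁻¹ : kˣ) * ev g (delta μ) := by
  by_cases hg : g ∈ borel F
  · have h : (⟨g * (b : G F), mul_mem hg b.2⟩ : borel F) = ⟨g, hg⟩ * b := rfl
    rw [ev_delta μ (mul_mem hg b.2), ev_delta μ hg, h, map_mul, map_mul, mul_inv_rev,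
      Units.val_mul]
  · rw [ev_delta_eq_zero μ hg, ev_delta_eq_zero μ (mt (mul_mem_cancel_right b.2).1 hg), mul_zero]

theorem act_delta (b : borel F) :
    act k (b : G F) (delta μ) = (μ (borelToTorus F b) : k) • delta μ := by
  refine fun_ext fun g => ?_
  rw [ev_act, map_smul, smul_eq_mul]
  by_cases hg : g ∈ borel F
  · rw [ev_delta μ (mul_mem (inv_mem b.2) hg), ev_delta μ hg, ← Units.val_mul]
    have h : borelToTorus F ⟨(b : G F)⁻¹ * g, mul_mem (inv_mem b.2) hg⟩ =
      (borelToTorus F b)⁻¹ * borelToTorus F ⟨g, hg⟩ := by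
      rw [← map_inv, ← map_mul]
      rfl
    rw [h, map_mul, map_inv, mul_inv, inv_inv]
  · rw [ev_delta_eq_zero μ hg,
      ev_delta_eq_zero μ (mt (mul_mem_cancel_left (inv_mem b.2)).1 hg), mul_zero]

/-- `M(μ)` embeds into the functions on `G`. -/
theorem exists_embedding : ∃ i : (indRep μ).asModule →ₗ[k[G F]] FunModule k F,
    Function.Injective i ∧ i (oneVec μ) = delta μ := by
  classical
  obtain ⟨i, hi⟩ := exists_ind_hom μ (delta μ) (act_delta μ)
  refine ⟨i, (injective_iff_map_eq_zero i).2 fun m hm => ?_, hi⟩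
  let Ψ : (G F ⧸ borel F →₀ k) →ₗ[k] (indRep μ).asModule :=
    Finsupp.linearCombination k fun q => act k q.out (oneVec μ)
  have hΨ : ∀ m, ∃ c, Ψ c = m := fun m => by
    induction m using ind_induction with
    | h c g =>
      obtain ⟨b, hb⟩ := QuotientGroup.mk_out_eq_mul (borel F) g
      refine ⟨Finsupp.single g (c * (μ (borelToTorus F b⁻¹) : k)), ?_⟩
      have hg : g = (g : G F ⧸ borel F).out * (b⁻¹ : borel F) := by rw [hb]; simp
      rw [Finsupp.linearCombination_single, mul_smul, ← act_smul, ← act_borel_oneVec, ← act_mul,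
        ← hg]
    | hadd x y hx hy =>
      obtain ⟨c, rfl⟩ := hx
      obtain ⟨d, rfl⟩ := hy
      exact ⟨c + d, map_add _ _ _⟩
  obtain ⟨c, rfl⟩ := hΨ m
  have hev : ∀ c q, ev q.out (i (Ψ c)) = c q := fun c q => by
    induction c using Finsupp.induction_linear with
    | zero => simp
    | add c d hc hd => rw [map_add, map_add, map_add, hc, hd, Finsupp.add_apply]
    | single r a =>
      rw [Finsupp.linearCombination_single, map_smul_scalar, map_act, hi, map_smul, ev_act,
        smul_eq_mul, Finsupp.single_apply]
      split_ifs with h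
      · subst h
        rw [inv_mul_cancel, ev_delta μ (one_mem _)]
        have : (⟨1, one_mem _⟩ : borel F) = 1 := rfl
        rw [this, map_one, map_one, inv_one, Units.val_one, mul_one]
      · rw [ev_delta_eq_zero, mul_zero]
        intro hmem
        apply h
        rw [← r.out_eq', ← q.out_eq']
        exact QuotientGroup.eq.2 hmem
  have : c = 0 := Finsupp.ext fun q => by rw [← hev, hm, map_zero, Finsupp.zero_apply]
  rw [this, map_zero]

variable {μ} {i : (indRep μ).asModule →ₗ[k[G F]] FunModule k F} (hi : i (oneVec μ) = delta μ)

include hi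

theorem ev_range_mul_diag (m : (indRep μ).asModule) (g : G F) (a : Fˣ) :
    ev (g * (diag a : G F)) (i m) = ((μ (diag a))⁻¹ : kˣ) * ev g (i m) := by
  induction m using ind_induction with
  | h c h =>
    have := ev_delta_mul μ (h⁻¹ * g) ⟨unip (0 : F) * diag a, mul_mem (unip_mem 0) (diag_mem a)⟩
    rw [borelToTorus_unip_mul_diag] at this
    simp only [unip_zero, one_mul] at this
    rw [map_smul_scalar, map_act, hi, map_smul, map_smul, ev_act, ev_act, ← mul_assoc, this,
      smul_eq_mul, smul_eq_mul, mul_left_comm]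
  | hadd x y hx hy => rw [map_add, map_add, map_add, hx, hy, mul_add]

theorem finite_support_range (m : (indRep μ).asModule) :
    {x : F | ev (unip x * weyl F) (i m) ≠ 0}.Finite := by
  induction m using ind_induction with
  | h c g =>
    refine Set.Subsingleton.finite fun x hx y hy => ?_
    have key : ∀ x : F, ev (unip x * weyl F) (i (c • act k g (oneVec μ))) ≠ 0 →
        g 0 0 = g 1 0 * x := fun x hx => by
      rw [map_smul_scalar, map_act, hi, map_smul, ev_act] at hx
      have := mem_borel.1 (mem_borel_of_ev_delta_ne_zero μ (right_ne_zero_of_smul hx))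
      rw [mul_apply_fin_two, inv_10, inv_11] at this
      simp only [mul_apply_fin_two, unip_00, unip_01, unip_10, unip_11, weyl_00, weyl_10] at this
      linear_combination this
    have hx' := key x hx
    have hy' := key y hy
    have h10 : g 1 0 ≠ 0 := fun h => by
      have := det_eq g
      rw [hx', h] at this
      simp at this
    exact mul_left_cancel₀ h10 (hx'.symm.trans hy')
  | hadd x y hx hy =>
    refine (hx.union hy).subset fun z hz => ?_
    by_contra h
    simp only [Set.mem_union, Set.mem_ofPred_eq, not_or, not_not] at h
    exact hz (by rw [map_add, map_add, h.1, h.2, add_zero])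

/-- A function which is nonzero at infinitely many points and zero at infinitely many points of
the open orbit of the torus is not congruent modulo `M(μ)` to an eigenvector of the torus. -/
theorem not_eigenvector_mod_range {V W : FunModule k F} (x : ℕ → F) (hx : Function.Injective x)
    (hx0 : ∀ n, x n ≠ 0) [IsAlgClosed F]
    (hV : ∀ (g : G F) (a : Fˣ), ev (g * (diag a : G F)) V = ((μ (diag a))⁻¹ : kˣ) * ev g V)
    (hV1 : ∀ n, ev (unip (x (2 * n)) * weyl F) V ≠ 0)
    (hV0 : ∀ n, ev (unip (x (2 * n + 1)) * weyl F) V = 0)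
    (hVW : V - W ∈ LinearMap.range i) (χ : Fˣ → k)
    (hW : ∀ a : Fˣ, act k (diag a : G F) W = χ a • W) : False := by
  obtain ⟨m, hm⟩ := hVW
  obtain rfl : W = V - i m := by rw [hm, sub_sub_cancel]
  obtain ⟨N, hN⟩ := ((finite_support_range hi m).preimage hx.injOn).bddAbove
  have hN' : ∀ n, N < n → ev (unip (x n) * weyl F) (i m) = 0 := fun n hn => by
    by_contra h
    exact absurd (hN h) (not_le.2 hn)
  have h1 : ev (unip (x (2 * (N + 1))) * weyl F) (V - i m) ≠ 0 := by
    rw [map_sub, hN' _ (by lia), sub_zero]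
    exact hV1 _
  have h0 : ev (unip (x (2 * (N + 1) + 1)) * weyl F) (V - i m) = 0 := by
    rw [map_sub, hN' _ (by lia), hV0, sub_zero]
  obtain ⟨b, hb⟩ := IsAlgClosed.exists_pow_nat_eq
    (x (2 * (N + 1)) / x (2 * (N + 1) + 1)) two_pos
  have hb0 : b ≠ 0 := by
    rintro rfl
    rw [zero_pow two_ne_zero] at hb
    exact div_ne_zero (hx0 _) (hx0 _) hb.symm
  apply h1
  let a : Fˣ := Units.mk0 b hb0
  have hax : x (2 * (N + 1)) = (a : F) ^ 2 * x (2 * (N + 1) + 1) := by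
    rw [Units.val_mk0, hb, div_mul_cancel₀ _ (hx0 _)]
  have hg : unip (x (2 * (N + 1))) * weyl F =
      (diag a⁻¹ : G F)⁻¹ * (unip (x (2 * (N + 1) + 1)) * weyl F * diag a) := by
    have : (diag a⁻¹ : G F)⁻¹ = diag a := by
      rw [inv_eq_iff_mul_eq_one, ← Subgroup.coe_mul, ← diag_mul, inv_mul_cancel]
      apply ext_entries <;> simp
    rw [this, mul_assoc _ (weyl F), weyl_mul_diag, ← mul_assoc, ← mul_assoc, diag_mul_unip, ← hax,
      mul_assoc _ (diag a : G F), ← Subgroup.coe_mul, ← diag_mul, mul_inv_cancel]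
    have h1 : ((diag (1 : Fˣ) : torus F) : G F) = 1 := by apply ext_entries <;> simp
    rw [h1, mul_one]
  rw [hg, ← ev_act, hW, map_smul, map_sub, hV, ev_range_mul_diag hi, ← mul_sub, ← map_sub, h0,
    mul_zero, smul_zero]

end Functions

namespace Tower

variable {k F : Type u} [Field k] [Field F] (T : Tower F) (H : Subgroup (G F)) (χ : H →* kˣ)
  (μ : TorusChar k F)

/-- The elements of `H` with entries in `K n`. -/
abbrev level (n : ℕ) : Subgroup H := (T.sl n).subgroupOf H

instance (n : ℕ) : Finite (T.level H n) :=
  Finite.of_injective (β := T.sl n) (fun h => ⟨h.1.1, h.2⟩) fun _ _ h =>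
    Subtype.ext (Subtype.ext (Subtype.mk.inj h))

instance (n : ℕ) : Fintype (T.level H n) := Fintype.ofFinite _

/-- The `χ`-weighted orbit sum of the point `x n` under the `n`-th level of `H`. -/
def orbitSum (n : ℕ) : FunModule k F :=
  ∑ h : T.level H n, ((χ h)⁻¹ : kˣ).val • act k (h.1 : G F) (act k (T.pt n) (delta μ))

theorem act_orbitSum {n : ℕ} (h : T.level H n) :
    act k (h.1 : G F) (T.orbitSum H χ μ n) = (χ h : k) • T.orbitSum H χ μ n := by
  have hsum : act k (h.1 : G F) (T.orbitSum H χ μ n) = ∑ h' : T.level H n,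
      ((χ h')⁻¹ : kˣ).val • act k ((h * h').1 : G F) (act k (T.pt n) (delta μ)) := by
    rw [orbitSum, act, Finset.smul_sum]
    refine Finset.sum_congr rfl fun h' _ => ?_
    rw [← act, act_smul, ← act_mul]
    rfl
  rw [hsum, orbitSum, Finset.smul_sum]
  refine Fintype.sum_equiv (Equiv.mulLeft h) _ _ fun h' => ?_
  rw [smul_smul, Equiv.coe_mulLeft, Subgroup.coe_mul, map_mul, mul_inv, ← Units.val_mul,
    mul_inv_cancel_left]

theorem orbitSum_mem {i : (indRep μ).asModule →ₗ[k[G F]] FunModule k F}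
    (hi : i (oneVec μ) = delta μ) (n : ℕ) : T.orbitSum H χ μ n ∈ LinearMap.range i := by
  refine sum_mem fun h _ => Submodule.smul_of_tower_mem _ _ ?_
  exact Submodule.smul_mem _ _ (Submodule.smul_mem _ _ ⟨_, hi⟩)

theorem exists_of_ev_orbitSum_ne_zero {n : ℕ} {g : G F} (hg : ev g (T.orbitSum H χ μ n) ≠ 0) :
    ∃ h ∈ H, h ∈ T.sl n ∧ (h * T.pt n)⁻¹ * g ∈ borel F := by
  rw [orbitSum, map_sum] at hg
  obtain ⟨h, -, hh⟩ := Finset.exists_ne_zero_of_sum_ne_zero hg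
  refine ⟨h.1, h.1.2, h.2, ?_⟩
  rw [map_smul, ← act_mul, ev_act] at hh
  exact mem_borel_of_ev_delta_ne_zero μ (right_ne_zero_of_smul hh)

theorem ev_orbitSum_eq_zero {m n : ℕ} {h : G F} (hh : h ∈ T.sl m) (hmn : n ≠ m) :
    ev (h * T.pt m) (T.orbitSum H χ μ n) = 0 := by
  by_contra h0
  obtain ⟨h', -, hh', hb⟩ := T.exists_of_ev_orbitSum_ne_zero H χ μ h0
  exact hmn (T.eq_of_mem_borel hh hh' hb).symm

theorem level_eq_of_ev_orbitSum_ne_zero {m n : ℕ} {g : G F}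
    (hm : ev g (T.orbitSum H χ μ m) ≠ 0) (hn : ev g (T.orbitSum H χ μ n) ≠ 0) : m = n := by
  obtain ⟨h, -, hh, hb⟩ := T.exists_of_ev_orbitSum_ne_zero H χ μ hm
  obtain ⟨h', -, hh', hb'⟩ := T.exists_of_ev_orbitSum_ne_zero H χ μ hn
  refine T.eq_of_mem_borel hh hh' ?_
  have := mul_mem hb' (inv_mem hb)
  convert this using 1
  group

theorem ev_pt_orbitSum_ne_zero (h2 : (2 : k) ≠ 0) (hH : (diag (-1 : Fˣ) : G F) ∈ H)
    (hχ : χ ⟨diag (-1 : Fˣ), hH⟩ = μ (diag (-1))) (n : ℕ) :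
    ev (T.pt n) (T.orbitSum H χ μ n) ≠ 0 := by
  classical
  have hone : ev (1 : G F) (delta μ) = 1 := by
    rw [ev_delta μ (one_mem _)]
    have : (⟨1, one_mem _⟩ : borel F) = 1 := rfl
    rw [this, map_one, map_one, inv_one, Units.val_one]
  have hinv : (diag (-1 : Fˣ) : G F)⁻¹ = diag (-1 : Fˣ) := by
    apply inv_eq_of_mul_eq_one_right
    apply ext_entries <;> simp [mul_apply_fin_two, inv_neg]
  have hneg : ev (diag (-1 : Fˣ) : G F) (delta μ) = ((μ (diag (-1)))⁻¹ : kˣ) := by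
    have := ev_delta_mul μ 1 ⟨unip (0 : F) * diag (-1 : Fˣ), mul_mem (unip_mem 0) (diag_mem _)⟩
    rw [borelToTorus_unip_mul_diag, hone] at this
    simpa using this
  let S : Finset (T.level H n) :=
    Finset.univ.filter fun h => (h.1 : G F) = 1 ∨ (h.1 : G F) = diag (-1 : Fˣ)
  have hsum : ev (T.pt n) (T.orbitSum H χ μ n) = S.card := by
    rw [orbitSum, map_sum, Finset.card_eq_sum_ones, Nat.cast_sum, Nat.cast_one,
      Finset.sum_filter]
    refine Finset.sum_congr rfl fun h _ => ?_
    rw [map_smul, ev_act, ev_act]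
    split_ifs with hh
    · rcases hh with hh | hh
      · have : h.1 = 1 := Subtype.ext hh
        rw [this]
        simp [hone]
      · have h' : h.1 = ⟨diag (-1 : Fˣ), hH⟩ := Subtype.ext hh
        rw [h', hχ, hinv, diag_neg_one_mul, inv_mul_cancel_left, hneg, smul_eq_mul,
          ← Units.val_mul, ← mul_inv, ← map_mul, ← diag_mul]
        have : diag ((-1 : Fˣ) * -1) = 1 := by
          apply Subtype.ext
          apply ext_entries <;> simp
        rw [this, map_one, inv_one, Units.val_one]
    · rw [ev_delta_eq_zero, smul_zero]
      intro hb
      apply hh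
      have := T.eq_one_or_of_mem_borel (inv_mem (show (h.1 : G F) ∈ T.sl n from h.2)) hb
      rwa [inv_eq_one, inv_eq_iff_eq_inv, hinv] at this
  have hS1 : 1 ∈ S := by simp [S]
  have hS2 : S.card ≤ 2 := by
    have : (S.image fun h => (h.1 : G F)) ⊆ {1, (diag (-1 : Fˣ) : G F)} := fun g hg => by
      obtain ⟨h, hh, rfl⟩ := Finset.mem_image.1 hg
      simpa [S] using hh
    rw [← Finset.card_image_of_injective S
      (f := fun h => (h.1 : G F)) (fun _ _ h => Subtype.ext (Subtype.ext h))]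
    exact (Finset.card_le_card this).trans Finset.card_le_two
  have hS0 : 0 < S.card := Finset.card_pos.2 ⟨1, hS1⟩
  rw [hsum]
  interval_cases S.card
  · simp
  · exact_mod_cast h2

/-- The infinite sum of the orbit sums of even index. -/
def infSum : FunModule k F := ofFun fun g => ∑ᶠ n, ev g (T.orbitSum H χ μ (2 * n))

theorem finite_support_orbitSum (g : G F) :
    (Function.support fun n => ev g (T.orbitSum H χ μ (2 * n))).Finite :=
  Set.Subsingleton.finite fun m hm n hn => by
    have := T.level_eq_of_ev_orbitSum_ne_zero H χ μ hm hn
    lia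

theorem ev_infSum_eq {g : G F} {m : ℕ}
    (h : ∀ n, n ≠ m → ev g (T.orbitSum H χ μ (2 * n)) = 0) :
    ev g (T.infSum H χ μ) = ev g (T.orbitSum H χ μ (2 * m)) := by
  rw [infSum, ev_ofFun, finsum_eq_single _ m h]

theorem ev_infSum_eq_zero {g : G F} (h : ∀ n, ev g (T.orbitSum H χ μ (2 * n)) = 0) :
    ev g (T.infSum H χ μ) = 0 := by
  rw [infSum, ev_ofFun, finsum_congr h, finsum_zero]

theorem ev_infSum_even (h2 : (2 : k) ≠ 0) (hH : (diag (-1 : Fˣ) : G F) ∈ H)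
    (hχ : χ ⟨diag (-1 : Fˣ), hH⟩ = μ (diag (-1))) (n : ℕ) :
    ev (T.pt (2 * n)) (T.infSum H χ μ) ≠ 0 := by
  rw [T.ev_infSum_eq H χ μ (m := n) fun m hm => ?_]
  · exact T.ev_pt_orbitSum_ne_zero H χ μ h2 hH hχ _
  · rw [← one_mul (T.pt (2 * n))]
    exact T.ev_orbitSum_eq_zero H χ μ (one_mem _) (by lia)

theorem ev_infSum_odd {n : ℕ} {h : G F} (hh : h ∈ T.sl (2 * n + 1)) :
    ev (h * T.pt (2 * n + 1)) (T.infSum H χ μ) = 0 :=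
  T.ev_infSum_eq_zero H χ μ fun m => T.ev_orbitSum_eq_zero H χ μ hh (by lia)

theorem ev_infSum_mul_diag {i : (indRep μ).asModule →ₗ[k[G F]] FunModule k F}
    (hi : i (oneVec μ) = delta μ) (g : G F) (a : Fˣ) :
    ev (g * (diag a : G F)) (T.infSum H χ μ) =
      ((μ (diag a))⁻¹ : kˣ) * ev g (T.infSum H χ μ) := by
  rw [infSum, ev_ofFun, ev_ofFun, mul_finsum]
  refine finsum_congr fun n => ?_
  obtain ⟨m, hm⟩ := T.orbitSum_mem H χ μ hi (2 * n)
  rw [← hm, ev_range_mul_diag hi]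

theorem act_infSum_sub_mem {i : (indRep μ).asModule →ₗ[k[G F]] FunModule k F}
    (hi : i (oneVec μ) = delta μ) (h : H) :
    act k (h : G F) (T.infSum H χ μ) - (χ h : k) • T.infSum H χ μ ∈ LinearMap.range i := by
  obtain ⟨N, hN⟩ := T.exists_mem_sl (h : G F)
  have : act k (h : G F) (T.infSum H χ μ) - (χ h : k) • T.infSum H χ μ =
      ∑ n ∈ Finset.range N, (act k (h : G F) (T.orbitSum H χ μ (2 * n)) -
        (χ h : k) • T.orbitSum H χ μ (2 * n)) := by
    refine fun_ext fun g => ?_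
    rw [map_sub, ev_act, map_smul, smul_eq_mul, infSum, ev_ofFun, ev_ofFun,
      mul_finsum,
      ← finsum_sub_distrib (T.finite_support_orbitSum H χ μ _)
        ((T.finite_support_orbitSum H χ μ g).subset (Function.support_mul_subset_right _ _)),
      map_sum]
    have hterm : ∀ n, ev ((h : G F)⁻¹ * g) (T.orbitSum H χ μ (2 * n)) -
        χ h * ev g (T.orbitSum H χ μ (2 * n)) =
        ev g (act k (h : G F) (T.orbitSum H χ μ (2 * n)) -
          (χ h : k) • T.orbitSum H χ μ (2 * n)) := fun n => by
      rw [map_sub, ev_act, map_smul, smul_eq_mul]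
    rw [finsum_congr hterm, finsum_eq_sum_of_support_subset]
    intro n hn
    rw [Finset.coe_range, Set.mem_Iio]
    by_contra hn'
    refine hn ?_
    have := T.act_orbitSum H χ μ (n := 2 * n) ⟨h, T.sl_mono (by lia) hN⟩
    beta_reduce
    rw [this, sub_self, map_zero]
  rw [this]
  refine sum_mem fun n _ => sub_mem (Submodule.smul_mem _ _ (T.orbitSum_mem H χ μ hi _))
    (Submodule.smul_of_tower_mem _ _ (T.orbitSum_mem H χ μ hi _))

theorem x_injective : Function.Injective T.x := fun m n h => by
  refine T.eq_of_mem_borel (one_mem _) (one_mem _) ?_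
  rw [pt, pt, h, inv_mul_cancel]
  exact one_mem _

/-- The value at `x (2 n)` of the translate of `infSum` by `s` vanishes if `H = B`. -/
theorem ev_act_weyl_infSum_even (χ : borel F →* kˣ) (n : ℕ) :
    ev (T.pt (2 * n)) (act k (weyl F) (T.infSum (borel F) χ μ)) = 0 := by
  rw [ev_act]
  refine T.ev_infSum_eq_zero (borel F) χ μ fun m => ?_
  by_contra h0
  have hs := inv_mem (T.weyl_mem_sl (2 * n))
  obtain ⟨h, hB, hh, hb⟩ := T.exists_of_ev_orbitSum_ne_zero (borel F) χ μ h0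
  have hmn := T.eq_of_mem_borel hs hh hb
  rw [← hmn] at hh
  have hb' : (T.pt (2 * n))⁻¹ * ((h⁻¹ * (weyl F)⁻¹) * T.pt (2 * n)) ∈ borel F := by
    rw [← hmn] at hb
    convert hb using 1
    group
  have h1 : h⁻¹ * (weyl F)⁻¹ ∈ borel F := by
    rcases T.eq_one_or_of_mem_borel (mul_mem (inv_mem hh) hs) hb' with h | h
    · rw [h]
      exact one_mem _
    · rw [h]
      exact diag_mem _
  have h2 : weyl F ∈ borel F := inv_mem_iff.1 ((mul_mem_cancel_left (inv_mem hB)).1 h1)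
  simp [mem_borel] at h2

end Tower

section Nonvanishing

variable {k F : Type u} [Field k] [Field F] [IsAlgClosed F] (T : Tower F) (h2 : (2 : k) ≠ 0)

include T h2

theorem nontrivial_ext1_ind_ind {θ μ : TorusChar k F} (h : θ (diag (-1)) = μ (diag (-1))) :
    Nontrivial (Ext1 (M θ) (M μ)) := by
  obtain ⟨i, hinj, hi⟩ := exists_embedding μ
  let χ : borel F →* kˣ := θ.comp (borelToTorus F)
  let V := T.infSum (borel F) χ μ
  have hχ : χ ⟨diag (-1 : Fˣ), diag_mem _⟩ = μ (diag (-1)) := by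
    have := borelToTorus_unip_mul_diag (0 : F) (-1)
    simp only [unip_zero, one_mul] at this
    rw [← h, MonoidHom.comp_apply, this]
  obtain ⟨φ, hφ⟩ := exists_ind_hom θ ((LinearMap.range i).mkQ V) fun b => by
    rw [← map_act, ← map_smul_scalar, ← sub_eq_zero, ← map_sub, ← LinearMap.mem_ker,
      Submodule.ker_mkQ]
    exact T.act_infSum_sub_mem (borel F) χ μ hi b
  refine nontrivial_ext_of_not_lift _ _ i hinj φ fun ψ hψ => ?_
  refine not_eigenvector_mod_range hi (V := V) (W := ψ (oneVec θ)) T.x T.x_injective T.x_ne_zero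
    (T.ev_infSum_mul_diag _ χ μ hi) (T.ev_infSum_even _ χ μ h2 _ hχ) (fun n => ?_) ?_
    (fun a => θ (diag a)) fun a => ?_
  · simpa [Tower.pt] using T.ev_infSum_odd _ χ μ (n := n) (one_mem _)
  · rw [← Submodule.ker_mkQ (LinearMap.range i), LinearMap.mem_ker, map_sub, ← hφ, ← hψ,
      LinearMap.comp_apply, sub_self]
  · rw [← map_act, act_diag_oneVec]
    exact map_smul_scalar ψ _ _

theorem nontrivial_ext1_tr_ind {μ : TorusChar k F} (h : μ (diag (-1)) = 1) :
    Nontrivial (Ext1 (tr k F) (M μ)) := by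
  obtain ⟨i, hinj, hi⟩ := exists_embedding μ
  let χ : (⊤ : Subgroup (G F)) →* kˣ := 1
  let V := T.infSum ⊤ χ μ
  obtain ⟨φ, hφ⟩ := exists_tr_hom (k := k) (F := F) ((LinearMap.range i).mkQ V) fun g => by
    rw [← map_act, ← sub_eq_zero, ← map_sub, ← LinearMap.mem_ker, Submodule.ker_mkQ]
    simpa [χ] using T.act_infSum_sub_mem ⊤ χ μ hi ⟨g, Subgroup.mem_top g⟩
  refine nontrivial_ext_of_not_lift _ _ i hinj φ fun ψ hψ => ?_
  refine not_eigenvector_mod_range hi (V := V) (W := ψ (trVec k F)) T.x T.x_injective T.x_ne_zero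
    (T.ev_infSum_mul_diag _ χ μ hi) (T.ev_infSum_even _ χ μ h2 (Subgroup.mem_top _) h.symm)
    (fun n => ?_) ?_ (fun a => 1) fun a => ?_
  · simpa [Tower.pt] using T.ev_infSum_odd _ χ μ (n := n) (one_mem _)
  · rw [← Submodule.ker_mkQ (LinearMap.range i), LinearMap.mem_ker, map_sub, ← hφ, ← hψ,
      LinearMap.comp_apply, sub_self]
  · rw [← map_act, act_tr, one_smul]

theorem nontrivial_ext1_steinberg_ind {μ : TorusChar k F} (h : μ (diag (-1)) = 1) :
    Nontrivial (Ext1 (St k F) (M μ)) := by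
  obtain ⟨i, hinj, hi⟩ := exists_embedding μ
  let χ : borel F →* kˣ := 1
  let V := T.infSum (borel F) χ μ
  obtain ⟨φ, hφ⟩ := exists_ind_hom (1 : TorusChar k F) ((LinearMap.range i).mkQ V) fun b => by
    rw [← map_act, ← map_smul_scalar, ← sub_eq_zero, ← map_sub, ← LinearMap.mem_ker,
      Submodule.ker_mkQ]
    exact T.act_infSum_sub_mem (borel F) χ μ hi b
  have hφ' : φ (steinbergVec k F) = (LinearMap.range i).mkQ (V - act k (weyl F) V) := by
    rw [steinbergVec_eq, map_sub, map_act, hφ, map_sub, map_act]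
  refine nontrivial_ext_of_not_lift _ _ i hinj (φ ∘ₗ Submodule.subtype _) fun ψ hψ => ?_
  refine not_eigenvector_mod_range hi (V := V - act k (weyl F) V) (W := ψ (stVec k F)) T.x
    T.x_injective T.x_ne_zero (fun g a => ?_) (fun n => ?_) (fun n => ?_) ?_
    (fun a => 1) fun a => ?_
  · rw [map_sub, map_sub, ev_act, ev_act, ← mul_assoc, T.ev_infSum_mul_diag _ χ μ hi,
      T.ev_infSum_mul_diag _ χ μ hi, mul_sub]
  · change ev (T.pt (2 * n)) _ ≠ 0
    rw [map_sub, T.ev_act_weyl_infSum_even μ χ, sub_zero]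
    exact T.ev_infSum_even _ χ μ h2 (diag_mem _) h.symm n
  · change ev (T.pt (2 * n + 1)) _ = 0
    have h1 := T.ev_infSum_odd (borel F) χ μ (n := n) (one_mem _)
    rw [one_mul] at h1
    rw [map_sub, h1, ev_act, T.ev_infSum_odd _ χ μ (inv_mem (T.weyl_mem_sl _)), sub_zero]
  · rw [← Submodule.ker_mkQ (LinearMap.range i), LinearMap.mem_ker, map_sub, ← hφ', sub_eq_zero]
    exact (LinearMap.congr_fun hψ (stVec k F)).symm
  · rw [← map_act, act_diag_stVec, one_smul]

end Nonvanishing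

section Main

variable {k F : Type u} [Field k] [Field F]

theorem apply_diag_neg_one_eq {θ μ : TorusChar k F} (h : resCenter θ = resCenter μ) :
    θ (diag (-1)) = μ (diag (-1)) :=
  DFunLike.congr_fun h ⟨(diag (-1 : Fˣ) : G F),
    Subgroup.mem_center_iff.2 fun g => (diag_neg_one_mul g).symm⟩

theorem nontrivial_ext1_steinberg_of_ind {X : ModuleCat.{u} k[G F]}
    (htr : Subsingleton (Ext1 X (tr k F))) (hM : Nontrivial (Ext1 X (M (1 : TorusChar k F)))) :
    Nontrivial (Ext1 X (St k F)) := by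
  obtain ⟨ε, -, hε, hker⟩ := exists_augmentation k F
  exact nontrivial_ext_of_ker (Z := M (1 : TorusChar k F)) (W := tr k F) _ ε hε hker htr hM

end Main

end SL2Ext

end

theorem mainTheorem3 {k F : Type u} {Fq : Type v} [Field k] [Field Fq] [Finite Fq] [Field F]
    [Algebra Fq F] [IsAlgClosure Fq F] (p l : ℕ) [CharP F p] [CharP k l]
    (hchar : (p ≠ l ∧ 3 ≤ l) ∨ l = 0) :
    -- `Ext¹(M, tr) = 0` for all `M` in the list `tr`, `St`, `M(θ)` with `θ` nontrivial
    (Subsingleton (SL2Ext.Ext1 (SL2Ext.tr k F) (SL2Ext.tr k F)) ∧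
      Subsingleton (SL2Ext.Ext1 (SL2Ext.St k F) (SL2Ext.tr k F)) ∧
      ∀ θ : SL2Ext.TorusChar k F, θ ≠ 1 →
        Subsingleton (SL2Ext.Ext1 (SL2Ext.M θ) (SL2Ext.tr k F))) ∧
    -- vanishing when `θ|_C` is nontrivial
    (∀ θ : SL2Ext.TorusChar k F, SL2Ext.resCenter θ ≠ 1 →
      Subsingleton (SL2Ext.Ext1 (SL2Ext.M θ) (SL2Ext.St k F)) ∧
      Subsingleton (SL2Ext.Ext1 (SL2Ext.tr k F) (SL2Ext.M θ)) ∧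
      Subsingleton (SL2Ext.Ext1 (SL2Ext.St k F) (SL2Ext.M θ))) ∧
    -- vanishing when `λ|_C ≠ μ|_C`
    (∀ lam mu : SL2Ext.TorusChar k F, SL2Ext.resCenter lam ≠ SL2Ext.resCenter mu →
      Subsingleton (SL2Ext.Ext1 (SL2Ext.M lam) (SL2Ext.M mu))) ∧
    -- all other pairs have nonzero `Ext¹`
    Nontrivial (SL2Ext.Ext1 (SL2Ext.tr k F) (SL2Ext.St k F)) ∧
    Nontrivial (SL2Ext.Ext1 (SL2Ext.St k F) (SL2Ext.St k F)) ∧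
    (∀ θ : SL2Ext.TorusChar k F, θ ≠ 1 → SL2Ext.resCenter θ = 1 →
      Nontrivial (SL2Ext.Ext1 (SL2Ext.M θ) (SL2Ext.St k F))) ∧
    (∀ θ : SL2Ext.TorusChar k F, SL2Ext.resCenter θ = 1 →
      Nontrivial (SL2Ext.Ext1 (SL2Ext.tr k F) (SL2Ext.M θ)) ∧
      Nontrivial (SL2Ext.Ext1 (SL2Ext.St k F) (SL2Ext.M θ))) ∧
    (∀ lam mu : SL2Ext.TorusChar k F, lam ≠ 1 → mu ≠ 1 →
      SL2Ext.resCenter lam = SL2Ext.resCenter mu →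
      Nontrivial (SL2Ext.Ext1 (SL2Ext.M lam) (SL2Ext.M mu))) := by
  have : IsAlgClosed F := IsAlgClosure.isAlgClosed Fq
  have : Algebra.IsAlgebraic Fq F := IsAlgClosure.isAlgebraic
  have hFq : CharP Fq p := (algebraMap Fq F).charP (algebraMap Fq F).injective p
  have hpp : p.Prime := CharP.char_is_prime Fq p
  have : Fact p.Prime := ⟨hpp⟩
  have hne : ∀ q : ℕ, q.Prime → (q ≠ l ∨ l = 0) → (q : k) ≠ 0 := fun q hq hql h0 => by
    have hdvd := (CharP.cast_eq_zero_iff k l q).1 h0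
    rcases hq.eq_one_or_self_of_dvd l hdvd with h1 | h1
    · exact CharP.char_ne_one k l h1
    · rcases hql with h | h
      · exact h h1.symm
      · exact hq.ne_zero (h1.symm.trans h)
  have hp : (p : k) ≠ 0 := hne p hpp (hchar.imp And.left id)
  have h2 : (2 : k) ≠ 0 := by
    exact_mod_cast hne 2 Nat.prime_two (hchar.imp (fun h => by lia) id)
  have ht : ∀ a : Fˣ, IsOfFinOrder a := fun a => by
    obtain ⟨K, hfin, -, hex⟩ := SL2Ext.exists_exhaustion (F := F) p Fq
    obtain ⟨n, hn⟩ := hex a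
    have := hfin n
    have ha0 : (⟨a, hn⟩ : K n) ≠ 0 := fun h => a.ne_zero (congrArg Subtype.val h)
    have h := isOfFinOrder_of_finite (Units.mk0 (⟨a, hn⟩ : K n) ha0)
    have h' := (Units.map ((K n).subtype : K n →* F)).isOfFinOrder h
    convert h'
    ext
    rfl
  have : Infinite F := IsAlgClosed.instInfinite
  obtain ⟨T⟩ := SL2Ext.exists_tower (F := F) p Fq
  have h1 : ∀ θ : SL2Ext.TorusChar k F, SL2Ext.resCenter θ = 1 →
      θ (SL2Ext.diag (-1)) = 1 := fun θ h => SL2Ext.apply_diag_neg_one_eq (μ := 1) h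
  have htr := SL2Ext.subsingleton_ext1_tr_tr hp ht h2
  have hst := SL2Ext.subsingleton_ext1_steinberg_tr ht h2
  have hind := SL2Ext.subsingleton_ext1_ind_tr hp ht
  exact ⟨⟨htr, hst, fun θ _ => hind θ⟩,
    fun θ hθ => ⟨SL2Ext.subsingleton_ext1_ind_steinberg hθ, SL2Ext.subsingleton_ext1_tr_ind hθ,
      SL2Ext.subsingleton_ext1_steinberg_ind hθ⟩,
    fun _ _ h => SL2Ext.subsingleton_ext1_ind_ind h,
    SL2Ext.nontrivial_ext1_steinberg_of_ind htr (SL2Ext.nontrivial_ext1_tr_ind T h2 rfl),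
    SL2Ext.nontrivial_ext1_steinberg_of_ind hst (SL2Ext.nontrivial_ext1_steinberg_ind T h2 rfl),
    fun θ _ h => SL2Ext.nontrivial_ext1_steinberg_of_ind (hind θ)
      (SL2Ext.nontrivial_ext1_ind_ind T h2 (h1 θ h)),
    fun θ h => ⟨SL2Ext.nontrivial_ext1_tr_ind T h2 (h1 θ h),
      SL2Ext.nontrivial_ext1_steinberg_ind T h2 (h1 θ h)⟩,
    fun _ _ _ _ h => SL2Ext.nontrivial_ext1_ind_ind T h2 (SL2Ext.apply_diag_neg_one_eq h)⟩
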